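/- Let $K$ be a commutative ring, let $G$ be any group and let $A=\bigoplus_{g\in G}A_g$ be a $G$-graded (associative, unital) $K$-algebra. Let $AG$ be the free left $A$-module with basis $G$, made into an $A$-bimodule by $g\,a = a\,(gh)$ for $g\in G$ and $a\in A$ homogeneous of degree $h$, and into an $A$-coring by $\Delta(ag)=ag\otimes_A g$ and $\epsilon(ag)=a$ for $a\in A$, $g\in G$. Then every $g\in G$ is a grouplike element of $AG$. For $g\in G$ let $[g]A$ be the right $AG$-comodule $A$ with coaction $a\mapsto 1\otimes_A ga$. For a subset $X\subseteq G$ put $A_{g,h}=\{b\in A : hb=bg\}$ for $g,h\in X$, and let $\mathfrak R(X)$ be the $A$-coring $$\mathfrak R(X)=\frac{\bigoplus_{g\in X}A\otimes_{A_{g,g}}A}{\langle a\otimes_{A_{h,h}}ta'-at\otimes_{A_{g,g}}a' \;:\; a,a'\in A,\ t\in A_{g,h},\ g,h\in X\rangle}$$ with comultiplication $a\otimes_{A_{g,g}}a'\mapsto (a\otimes_{A_{g,g}}1)\otimes_A(1\otimes_{A_{g,g}}a')$ and counit $a\otimes_{A_{g,g}} a'\mapsto aa'$; let $\mathsf{can}:\mathfrak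 R(X)\to AG$ be the map $a\otimes_{A_{g,g}}a'\mapsto aga'$. Then: 1. The category of right $AG$-comodules is isomorphic to the category $gr\text{-}A$ of $G$-graded right $A$-modules, by an isomorphism that commutes with the forgetful functors to right $A$-modules. For each $g\in G$ it takes $[g]A$ to the shift of the graded module $A$ whose component of degree $x$ is $A_{g^{-1}x}$. 2. The set $\{[g]A : g\in G\}$ of shifts of $A$ is a generating set of small projective objects of $gr\text{-}A$. (An object is small if every morphism from it to a coproduct factors through a finite subcoproduct.) 3. The canonical map $\mathsf{can}:\mathfrak R(G)\to AG$ is an isomorphism of $A$-corings. 4. More generally, for each subgroup $H$ of $G$ such that $\bigoplus_{h\in H}[h]A$ is a generator of $gr\text{-}A$, the canonical map $\mathsf{can}:\mathfrak R(H)\to AG$ is an isomorphism of $A$-corings. -/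

import Mathlib

open MulOpposite
open scoped TensorProduct DirectSum

universe u v w

noncomputable section

set_option linter.unusedSectionVars false

/-! ### Tensor products over a noncommutative ring

Right `A`-modules are modules over `Aᵐᵒᵖ`, so `op a • m` is `m a`; an `A`-bimodule (over the
base ring `K`) has commuting actions of `A` and `Aᵐᵒᵖ`, both extending the same action of `K`. -/

section BalancedTensor

variable {K A : Type*} [CommRing K] [Ring A] [Algebra K A]

/-- The relations `m b ⊗ n = m ⊗ b n` for `b` in a subalgebra `B` of `A`. -/
def balancedRel (B : Subalgebra K A) (M N : Type*) [AddCommGroup M] [Module K M]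
    [Module Aᵐᵒᵖ M] [AddCommGroup N] [Module K N] [Module A N] : Submodule K (M ⊗[K] N) :=
  Submodule.span K
    {x | ∃ (m : M) (b : A) (n : N), b ∈ B ∧ x = (op b • m) ⊗ₜ[K] n - m ⊗ₜ[K] (b • n)}

/-- The tensor product `M ⊗_B N` over a subalgebra `B` of `A`, for a right `A`-module `M` and a
left `A`-module `N`. -/
def BTensor (B : Subalgebra K A) (M N : Type*) [AddCommGroup M] [Module K M]
    [Module Aᵐᵒᵖ M] [AddCommGroup N] [Module K N] [Module A N] : Type _ :=
  (M ⊗[K] N) ⧸ balancedRel B M N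

namespace BTensor

section Basic

variable (B : Subalgebra K A) (M N : Type*) [AddCommGroup M] [Module K M]
    [Module Aᵐᵒᵖ M] [AddCommGroup N] [Module K N] [Module A N]

instance : AddCommGroup (BTensor B M N) :=
  inferInstanceAs (AddCommGroup ((M ⊗[K] N) ⧸ balancedRel B M N))

instance : Module K (BTensor B M N) :=
  inferInstanceAs (Module K ((M ⊗[K] N) ⧸ balancedRel B M N))

/-- The universal balanced bilinear map `(m, n) ↦ m ⊗ n`. -/
def mk : M →ₗ[K] N →ₗ[K] BTensor B M N :=
  (TensorProduct.mk K M N).compr₂ (balancedRel B M N).mkQ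

variable {M N}

theorem mk_smul (m : M) {b : A} (hb : b ∈ B) (n : N) :
    mk B M N (op b • m) n = mk B M N m (b • n) := by
  refine (Submodule.Quotient.eq _).2 (Submodule.subset_span ⟨m, b, n, hb, rfl⟩)

variable {B}

/-- The linear map on `M ⊗_B N` induced by a balanced bilinear map. -/
def lift {P : Type*} [AddCommGroup P] [Module K P] (f : M →ₗ[K] N →ₗ[K] P)
    (hf : ∀ m, ∀ b ∈ B, ∀ n, f (op b • m) n = f m (b • n)) : BTensor B M N →ₗ[K] P :=
  (balancedRel B M N).liftQ (TensorProduct.lift f) <| by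
    rw [balancedRel, Submodule.span_le]
    rintro _ ⟨m, b, n, hb, rfl⟩
    simp [hf m b hb n]

@[simp] theorem lift_mk {P : Type*} [AddCommGroup P] [Module K P] (f : M →ₗ[K] N →ₗ[K] P)
    (hf : ∀ m, ∀ b ∈ B, ∀ n, f (op b • m) n = f m (b • n)) (m : M) (n : N) :
    lift f hf (mk B M N m n) = f m n := by
  change TensorProduct.lift f (m ⊗ₜ n) = _
  simp

theorem hom_ext {P : Type*} [AddCommGroup P] [Module K P] {f g : BTensor B M N →ₗ[K] P}
    (h : ∀ m n, f (mk B M N m n) = g (mk B M N m n)) : f = g := by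
  apply Submodule.linearMap_qext
  apply TensorProduct.ext'
  exact h

end Basic

section Actions

variable {B : Subalgebra K A}

/-- `f ⊗_B g` for a right `A`-linear map `f` and a left `A`-linear map `g`. -/
def map {M M' N N' : Type*}
    [AddCommGroup M] [Module K M] [Module Aᵐᵒᵖ M] [IsScalarTower K Aᵐᵒᵖ M]
    [AddCommGroup M'] [Module K M'] [Module Aᵐᵒᵖ M'] [IsScalarTower K Aᵐᵒᵖ M']
    [AddCommGroup N] [Module K N] [Module A N] [IsScalarTower K A N]
    [AddCommGroup N'] [Module K N'] [Module A N'] [IsScalarTower K A N']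
    (f : M →ₗ[Aᵐᵒᵖ] M') (g : N →ₗ[A] N') : BTensor B M N →ₗ[K] BTensor B M' N' :=
  lift ((mk B M' N').compl₁₂ (f.restrictScalars K) (g.restrictScalars K)) fun m b hb n => by
    simp [mk_smul B _ hb]

@[simp] theorem map_mk {M M' N N' : Type*}
    [AddCommGroup M] [Module K M] [Module Aᵐᵒᵖ M] [IsScalarTower K Aᵐᵒᵖ M]
    [AddCommGroup M'] [Module K M'] [Module Aᵐᵒᵖ M'] [IsScalarTower K Aᵐᵒᵖ M']
    [AddCommGroup N] [Module K N] [Module A N] [IsScalarTower K A N]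
    [AddCommGroup N'] [Module K N'] [Module A N'] [IsScalarTower K A N']
    (f : M →ₗ[Aᵐᵒᵖ] M') (g : N →ₗ[A] N') (m : M) (n : N) :
    map (B := B) f g (mk B M N m n) = mk B M' N' (f m) (g n) := by
  simp [map]

/-- Left multiplication `m ↦ a m` on a bimodule, as a right `A`-linear map. -/
def lmul {M : Type*} [AddCommGroup M] [Module A M] [Module Aᵐᵒᵖ M] [SMulCommClass A Aᵐᵒᵖ M]
    (a : A) : M →ₗ[Aᵐᵒᵖ] M where
  toFun m := a • m
  map_add' := smul_add a
  map_smul' r m := smul_comm a r m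

/-- Right multiplication `n ↦ n a` on a bimodule, as a left `A`-linear map. -/
def rmul {N : Type*} [AddCommGroup N] [Module A N] [Module Aᵐᵒᵖ N] [SMulCommClass A Aᵐᵒᵖ N]
    (r : Aᵐᵒᵖ) : N →ₗ[A] N where
  toFun n := r • n
  map_add' := smul_add r
  map_smul' a n := (smul_comm a r n).symm

section Left

variable {M N : Type*}
    [AddCommGroup M] [Module K M] [Module A M] [Module Aᵐᵒᵖ M] [SMulCommClass A Aᵐᵒᵖ M]
    [IsScalarTower K A M] [IsScalarTower K Aᵐᵒᵖ M]
    [AddCommGroup N] [Module K N] [Module A N] [IsScalarTower K A N]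

/-- The left action `a (m ⊗ n) = a m ⊗ n`. -/
instance : SMul A (BTensor B M N) := ⟨fun a => map (lmul a) LinearMap.id⟩

theorem smul_def (a : A) (x : BTensor B M N) : a • x = map (lmul a) LinearMap.id x := rfl

@[simp] theorem smul_mk (a : A) (m : M) (n : N) :
    a • mk B M N m n = mk B M N (a • m) n := by
  simp [smul_def, lmul]

instance : Module A (BTensor B M N) where
  one_smul x := by
    have : map (B := B) (lmul (M := M) (1 : A)) (LinearMap.id (M := N)) = LinearMap.id :=
      hom_ext fun m n => by simp [lmul]
    exact LinearMap.congr_fun this x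
  mul_smul a b x := by
    have : map (B := B) (lmul (M := M) (a * b)) (LinearMap.id (M := N)) =
        map (lmul a) LinearMap.id ∘ₗ map (lmul b) LinearMap.id :=
      hom_ext fun m n => by simp [lmul, mul_smul]
    exact LinearMap.congr_fun this x
  smul_zero a := map_zero _
  smul_add a := map_add _
  add_smul a b x := by
    have : map (B := B) (lmul (M := M) (a + b)) (LinearMap.id (M := N)) =
        map (lmul a) LinearMap.id + map (lmul b) LinearMap.id :=
      hom_ext fun m n => by simp [lmul, add_smul]
    exact LinearMap.congr_fun this x
  zero_smul x := by
    have : map (B := B) (lmul (M := M) (0 : A)) (LinearMap.id (M := N)) = 0 :=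
      hom_ext fun m n => by simp [lmul]
    exact LinearMap.congr_fun this x

instance : IsScalarTower K A (BTensor B M N) := ⟨fun k a x => by
  have : map (B := B) (lmul (M := M) (k • a)) (LinearMap.id (M := N)) =
      k • map (lmul a) LinearMap.id :=
    hom_ext fun m n => by simp [lmul]
  exact LinearMap.congr_fun this x⟩

end Left

section Right

variable {M N : Type*}
    [AddCommGroup M] [Module K M] [Module Aᵐᵒᵖ M] [IsScalarTower K Aᵐᵒᵖ M]
    [AddCommGroup N] [Module K N] [Module A N] [Module Aᵐᵒᵖ N] [SMulCommClass A Aᵐᵒᵖ N]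
    [IsScalarTower K A N] [IsScalarTower K Aᵐᵒᵖ N]

/-- The right action `(m ⊗ n) a = m ⊗ n a`. -/
instance : SMul Aᵐᵒᵖ (BTensor B M N) := ⟨fun r => map LinearMap.id (rmul r)⟩

theorem op_smul_def (r : Aᵐᵒᵖ) (x : BTensor B M N) :
    r • x = map LinearMap.id (rmul r) x := rfl

@[simp] theorem op_smul_mk (r : Aᵐᵒᵖ) (m : M) (n : N) :
    r • mk B M N m n = mk B M N m (r • n) := by
  simp [op_smul_def, rmul]

instance : Module Aᵐᵒᵖ (BTensor B M N) where
  one_smul x := by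
    have : map (B := B) (LinearMap.id (M := M)) (rmul (N := N) (1 : Aᵐᵒᵖ)) = LinearMap.id :=
      hom_ext fun m n => by simp [rmul]
    exact LinearMap.congr_fun this x
  mul_smul a b x := by
    have : map (B := B) (LinearMap.id (M := M)) (rmul (N := N) (a * b)) =
        map LinearMap.id (rmul a) ∘ₗ map LinearMap.id (rmul b) :=
      hom_ext fun m n => by simp [rmul, mul_smul]
    exact LinearMap.congr_fun this x
  smul_zero a := map_zero _
  smul_add a := map_add _
  add_smul a b x := by
    have : map (B := B) (LinearMap.id (M := M)) (rmul (N := N) (a + b)) =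
        map LinearMap.id (rmul a) + map LinearMap.id (rmul b) :=
      hom_ext fun m n => by simp [rmul, add_smul]
    exact LinearMap.congr_fun this x
  zero_smul x := by
    have : map (B := B) (LinearMap.id (M := M)) (rmul (N := N) (0 : Aᵐᵒᵖ)) = 0 :=
      hom_ext fun m n => by simp [rmul]
    exact LinearMap.congr_fun this x

instance : IsScalarTower K Aᵐᵒᵖ (BTensor B M N) := ⟨fun k a x => by
  have : map (B := B) (LinearMap.id (M := M)) (rmul (N := N) (k • a)) =
      k • map LinearMap.id (rmul a) :=
    hom_ext fun m n => by simp [rmul]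
  exact LinearMap.congr_fun this x⟩

end Right

instance {M N : Type*}
    [AddCommGroup M] [Module K M] [Module A M] [Module Aᵐᵒᵖ M] [SMulCommClass A Aᵐᵒᵖ M]
    [IsScalarTower K A M] [IsScalarTower K Aᵐᵒᵖ M]
    [AddCommGroup N] [Module K N] [Module A N] [Module Aᵐᵒᵖ N] [SMulCommClass A Aᵐᵒᵖ N]
    [IsScalarTower K A N] [IsScalarTower K Aᵐᵒᵖ N] :
    SMulCommClass A Aᵐᵒᵖ (BTensor B M N) := ⟨fun a r x => by
  have : map (B := B) (lmul (M := M) a) (LinearMap.id (M := N)) ∘ₗ map LinearMap.id (rmul r) =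
      map LinearMap.id (rmul r) ∘ₗ map (lmul a) LinearMap.id :=
    hom_ext fun m n => by simp [lmul, rmul]
  exact LinearMap.congr_fun this x⟩

end Actions

end BTensor

/-- The tensor product `M ⊗_A N`. -/
abbrev TensorA (K A M N : Type*) [CommRing K] [Ring A] [Algebra K A] [AddCommGroup M]
    [Module K M] [Module Aᵐᵒᵖ M] [AddCommGroup N] [Module K N] [Module A N] : Type _ :=
  BTensor (⊤ : Subalgebra K A) M N

namespace TensorA

/-- The left `A`-linear map `m ↦ m ⊗ n`. -/
def insertRight (K : Type*) {A : Type*} [CommRing K] [Ring A] [Algebra K A] (M : Type*)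
    {N : Type*} [AddCommGroup M] [Module K M] [Module A M] [Module Aᵐᵒᵖ M]
    [SMulCommClass A Aᵐᵒᵖ M] [IsScalarTower K A M] [IsScalarTower K Aᵐᵒᵖ M]
    [AddCommGroup N] [Module K N] [Module A N] [IsScalarTower K A N] (n : N) :
    M →ₗ[A] TensorA K A M N where
  toFun m := BTensor.mk ⊤ M N m n
  map_add' _ _ := by simp
  map_smul' _ _ := by simp

/-- The associativity map `(L ⊗_A M) ⊗_A N → L ⊗_A (M ⊗_A N)`. -/
def assoc (L M N : Type*)
    [AddCommGroup L] [Module K L] [Module Aᵐᵒᵖ L] [IsScalarTower K Aᵐᵒᵖ L]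
    [AddCommGroup M] [Module K M] [Module A M] [Module Aᵐᵒᵖ M] [SMulCommClass A Aᵐᵒᵖ M]
    [IsScalarTower K A M] [IsScalarTower K Aᵐᵒᵖ M]
    [AddCommGroup N] [Module K N] [Module A N] [IsScalarTower K A N] :
    TensorA K A (TensorA K A L M) N →ₗ[K] TensorA K A L (TensorA K A M N) :=
  BTensor.lift
    (LinearMap.mk₂ K (fun x n => BTensor.map LinearMap.id (insertRight K M n) x)
      (fun x y n => map_add _ x y) (fun k x n => map_smul _ k x)
      (fun x n n' => by
        have : BTensor.map (B := (⊤ : Subalgebra K A)) (LinearMap.id (M := L)) (insertRight K (A := A) M (n + n')) =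
            BTensor.map LinearMap.id (insertRight K M n) +
              BTensor.map LinearMap.id (insertRight K M n') :=
          BTensor.hom_ext fun l m => by simp [insertRight]
        exact LinearMap.congr_fun this x)
      (fun k x n => by
        have : BTensor.map (B := (⊤ : Subalgebra K A)) (LinearMap.id (M := L)) (insertRight K M (k • n)) =
            k • BTensor.map LinearMap.id (insertRight K M n) :=
          BTensor.hom_ext fun l m => by simp [insertRight]
        exact LinearMap.congr_fun this x))
    (fun x a _ n => by
      have : BTensor.map (B := (⊤ : Subalgebra K A)) (LinearMap.id (M := L)) (insertRight K M n) ∘ₗ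
            BTensor.map LinearMap.id (BTensor.rmul (op a)) =
          BTensor.map LinearMap.id (insertRight K M (a • n)) :=
        BTensor.hom_ext fun l m => by
          simp [insertRight, BTensor.rmul, BTensor.mk_smul _ m (Algebra.mem_top (x := a))]
      exact LinearMap.congr_fun this x)

@[simp] theorem assoc_mk {L M N : Type*}
    [AddCommGroup L] [Module K L] [Module Aᵐᵒᵖ L] [IsScalarTower K Aᵐᵒᵖ L]
    [AddCommGroup M] [Module K M] [Module A M] [Module Aᵐᵒᵖ M] [SMulCommClass A Aᵐᵒᵖ M]
    [IsScalarTower K A M] [IsScalarTower K Aᵐᵒᵖ M]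
    [AddCommGroup N] [Module K N] [Module A N] [IsScalarTower K A N] (l : L) (m : M) (n : N) :
    assoc L M N (BTensor.mk (⊤ : Subalgebra K A) _ _ (BTensor.mk ⊤ _ _ l m) n) =
      BTensor.mk ⊤ _ _ l (BTensor.mk ⊤ _ _ m n) := by
  refine (BTensor.lift_mk _ _ _ _).trans ?_
  simp [insertRight]

/-- The canonical map `A ⊗_A N → N`, `a ⊗ n ↦ a n`. -/
def lid (N : Type*) [AddCommGroup N] [Module K N] [Module A N] [IsScalarTower K A N] :
    TensorA K A A N →ₗ[K] N :=
  BTensor.lift (Algebra.lsmul K K N).toLinearMap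
    (fun a b _ n => (mul_smul a b n : (a * b) • n = a • b • n))

@[simp] theorem lid_mk {N : Type*} [AddCommGroup N] [Module K N] [Module A N]
    [IsScalarTower K A N] (a : A) (n : N) :
    lid N (BTensor.mk (⊤ : Subalgebra K A) A N a n) = a • n :=
  BTensor.lift_mk _ _ _ _

/-- The canonical map `M ⊗_A A → M`, `m ⊗ a ↦ m a`. -/
def rid (M : Type*) [AddCommGroup M] [Module K M] [Module Aᵐᵒᵖ M] [IsScalarTower K Aᵐᵒᵖ M] :
    TensorA K A M A →ₗ[K] M :=
  BTensor.lift (LinearMap.mk₂ K (fun m (a : A) => op a • m) (fun _ _ _ => smul_add _ _ _)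
    (fun k m a => smul_comm (op a) k m) (fun m a b => by rw [MulOpposite.op_add, add_smul])
    (fun k m a => by rw [MulOpposite.op_smul, smul_assoc]))
    (fun m b _ a => (mul_smul (op a) (op b) m).symm)

@[simp] theorem rid_mk {M : Type*} [AddCommGroup M] [Module K M] [Module Aᵐᵒᵖ M]
    [IsScalarTower K Aᵐᵒᵖ M] (m : M) (a : A) :
    rid M (BTensor.mk (⊤ : Subalgebra K A) M A m a) = op a • m :=
  BTensor.lift_mk _ _ _ _

end TensorA

end BalancedTensor

/-! ### Corings and comodules -/

section Coring

/-- Homomorphisms of `A`-bimodules. -/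
structure BimodHom (A C D : Type*) [Ring A] [AddCommGroup C] [Module A C] [Module Aᵐᵒᵖ C]
    [AddCommGroup D] [Module A D] [Module Aᵐᵒᵖ D] where
  left : C →ₗ[A] D
  map_op_smul : ∀ (r : Aᵐᵒᵖ) (c : C), left (r • c) = r • left c

/-- The right `A`-linear map underlying a bimodule homomorphism. -/
def BimodHom.right {A C D : Type*} [Ring A] [AddCommGroup C] [Module A C] [Module Aᵐᵒᵖ C]
    [AddCommGroup D] [Module A D] [Module Aᵐᵒᵖ D] (f : BimodHom A C D) : C →ₗ[Aᵐᵒᵖ] D where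
  toFun := f.left
  map_add' := map_add f.left
  map_smul' := f.map_op_smul

@[simp] theorem BimodHom.right_apply {A C D : Type*} [Ring A] [AddCommGroup C] [Module A C]
    [Module Aᵐᵒᵖ C] [AddCommGroup D] [Module A D] [Module Aᵐᵒᵖ D] (f : BimodHom A C D) (c : C) :
    f.right c = f.left c := rfl

/-- The structure of an `A`-coring on an `A`-bimodule `C`. -/
structure Coring (K A C : Type*) [CommRing K] [Ring A] [Algebra K A] [AddCommGroup C]
    [Module K C] [Module A C] [Module Aᵐᵒᵖ C] [SMulCommClass A Aᵐᵒᵖ C] [IsScalarTower K A C]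
    [IsScalarTower K Aᵐᵒᵖ C] where
  /-- The comultiplication. -/
  comul : BimodHom A C (TensorA K A C C)
  /-- The counit. -/
  counit : BimodHom A C A
  coassoc : ∀ c, TensorA.assoc C C C (BTensor.map comul.right LinearMap.id (comul.left c)) =
    BTensor.map LinearMap.id comul.left (comul.left c)
  counit_comul : ∀ c,
    TensorA.lid C (BTensor.map counit.right LinearMap.id (comul.left c)) = c
  comul_counit : ∀ c,
    TensorA.rid C (BTensor.map LinearMap.id counit.left (comul.left c)) = c

namespace Coring

variable {K A C : Type*} [CommRing K] [Ring A] [Algebra K A] [AddCommGroup C]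
    [Module K C] [Module A C] [Module Aᵐᵒᵖ C] [SMulCommClass A Aᵐᵒᵖ C] [IsScalarTower K A C]
    [IsScalarTower K Aᵐᵒᵖ C]
    {D : Type*} [AddCommGroup D]
    [Module K D] [Module A D] [Module Aᵐᵒᵖ D] [SMulCommClass A Aᵐᵒᵖ D] [IsScalarTower K A D]
    [IsScalarTower K Aᵐᵒᵖ D]

/-- Grouplike elements: `Δ(g) = g ⊗ g` and `ε(g) = 1`. -/
structure IsGrouplike (𝒞 : Coring K A C) (g : C) : Prop where
  comul_eq : 𝒞.comul.left g = BTensor.mk ⊤ C C g g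
  counit_eq : 𝒞.counit.left g = 1

/-- A bimodule homomorphism which is an isomorphism of `A`-corings: it is bijective and
compatible with the comultiplications and the counits. -/
structure IsIso (𝒞 : Coring K A C) (𝒟 : Coring K A D) (f : BimodHom A C D) : Prop where
  comul_map : ∀ c, 𝒟.comul.left (f.left c) = BTensor.map f.right f.left (𝒞.comul.left c)
  counit_map : ∀ c, 𝒟.counit.left (f.left c) = 𝒞.counit.left c
  bijective : Function.Bijective f.left

end Coring

end Coring

/-! ### The coring of a family of grouplike elements -/

section GrouplikeCoring

variable {K A C : Type*} [CommRing K] [Ring A] [Algebra K A] [AddCommGroup C]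
    [Module K C] [Module A C] [Module Aᵐᵒᵖ C] [SMulCommClass A Aᵐᵒᵖ C] [IsScalarTower K A C]
    [IsScalarTower K Aᵐᵒᵖ C] {ι : Type*}

variable (K A) in
/-- `A_{i,j} = {b ∈ A | γ_j b = b γ_i}`. -/
def intertwiner (γ : ι → C) (i j : ι) : Submodule K A where
  carrier := {b | op b • γ j = b • γ i}
  zero_mem' := by simp
  add_mem' {a b} (ha : op a • γ j = a • γ i) (hb : op b • γ j = b • γ i) := by
    change op (a + b) • γ j = (a + b) • γ i
    rw [op_add, add_smul, add_smul, ha, hb]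
  smul_mem' k a (ha : op a • γ j = a • γ i) := by
    change op (k • a) • γ j = (k • a) • γ i
    rw [op_smul, smul_assoc, smul_assoc, ha]

variable (K A) in
/-- The subring `A_{i,i} = {b ∈ A | γ_i b = b γ_i}` of `A`. -/
def centralizerAt (γ : ι → C) (i : ι) : Subalgebra K A where
  carrier := {b | op b • γ i = b • γ i}
  zero_mem' := by simp
  one_mem' := by simp
  add_mem' {a b} (ha : op a • γ i = a • γ i) (hb : op b • γ i = b • γ i) := by
    change op (a + b) • γ i = (a + b) • γ i
    rw [op_add, add_smul, add_smul, ha, hb]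
  mul_mem' {a b} (ha : op a • γ i = a • γ i) (hb : op b • γ i = b • γ i) := by
    change op (a * b) • γ i = (a * b) • γ i
    rw [op_mul, mul_smul, mul_smul, ha, ← smul_comm a (op b), hb]
  algebraMap_mem' k := by
    change op (algebraMap K A k) • γ i = algebraMap K A k • γ i
    rw [Algebra.algebraMap_eq_smul_one, op_smul, smul_assoc, smul_assoc]
    simp

variable (K A) in
/-- The coproduct `⨁_i A ⊗_{A_{i,i}} A` of Sweedler bimodules. -/
abbrev SweedlerSum (γ : ι → C) : Type _ :=
  ⨁ i, BTensor (centralizerAt K A γ i) A A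

variable [DecidableEq ι]

variable (K A) in
/-- The element `a ⊗ a'` of the summand `A ⊗_{A_{i,i}} A`. -/
def sweedlerMk (γ : ι → C) (i : ι) : A →ₗ[K] A →ₗ[K] SweedlerSum K A γ :=
  (BTensor.mk (centralizerAt K A γ i) A A).compr₂
    (DirectSum.lof K ι (fun i => BTensor (centralizerAt K A γ i) A A) i)

variable (K A) in
/-- The `K`-submodule `𝔍` spanned by the elements `a ⊗_{A_{j,j}} t a' - a t ⊗_{A_{i,i}} a'`
for `t ∈ A_{i,j}`. -/
def comatrixRel (γ : ι → C) : Submodule K (SweedlerSum K A γ) :=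
  Submodule.span K {x | ∃ (i j : ι) (a a' t : A), t ∈ intertwiner K A γ i j ∧
    x = sweedlerMk K A γ j a (t * a') - sweedlerMk K A γ i (a * t) a'}

variable (K A) in
/-- The bimodule `ℜ(γ) = (⨁_i A ⊗_{A_{i,i}} A) / 𝔍`. -/
def ComatrixCoring (γ : ι → C) : Type _ := SweedlerSum K A γ ⧸ comatrixRel K A γ

namespace ComatrixCoring

variable (γ : ι → C)

instance : AddCommGroup (ComatrixCoring K A γ) :=
  inferInstanceAs (AddCommGroup (SweedlerSum K A γ ⧸ comatrixRel K A γ))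

instance : Module K (ComatrixCoring K A γ) :=
  inferInstanceAs (Module K (SweedlerSum K A γ ⧸ comatrixRel K A γ))

/-- The class of `a ⊗_{A_{i,i}} a'`. -/
def mk (i : ι) : A →ₗ[K] A →ₗ[K] ComatrixCoring K A γ :=
  (sweedlerMk K A γ i).compr₂ (comatrixRel K A γ).mkQ

variable {γ}

theorem mk_mul {i j : ι} {t : A} (ht : t ∈ intertwiner K A γ i j) (a a' : A) :
    mk (K := K) γ j a (t * a') = mk γ i (a * t) a' :=
  (Submodule.Quotient.eq _).2 (Submodule.subset_span ⟨i, j, a, a', t, ht, rfl⟩)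

theorem hom_ext {P : Type*} [AddCommGroup P] [Module K P] {f g : ComatrixCoring K A γ →ₗ[K] P}
    (h : ∀ i a a', f (mk γ i a a') = g (mk γ i a a')) : f = g := by
  apply Submodule.linearMap_qext
  refine DirectSum.linearMap_ext K fun i => ?_
  exact BTensor.hom_ext fun a a' => h i a a'

/-- The linear map on `ℜ(γ)` induced by a compatible family of bilinear maps. -/
def lift {P : Type*} [AddCommGroup P] [Module K P] (f : ι → A →ₗ[K] A →ₗ[K] P)
    (hf : ∀ i j, ∀ t ∈ intertwiner K A γ i j, ∀ a a', f j a (t * a') = f i (a * t) a') :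
    ComatrixCoring K A γ →ₗ[K] P :=
  (comatrixRel K A γ).liftQ
    (DirectSum.toModule K ι P fun i => BTensor.lift (f i) fun a t ht a' =>
      (hf i i t ht a a').symm) <| by
    rw [comatrixRel, Submodule.span_le]
    rintro _ ⟨i, j, a, a', t, ht, rfl⟩
    simp [sweedlerMk, hf i j t ht]

@[simp] theorem lift_mk {P : Type*} [AddCommGroup P] [Module K P] (f : ι → A →ₗ[K] A →ₗ[K] P)
    (hf : ∀ i j, ∀ t ∈ intertwiner K A γ i j, ∀ a a', f j a (t * a') = f i (a * t) a')
    (i : ι) (a a' : A) : lift f hf (mk γ i a a') = f i a a' := by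
  change DirectSum.toModule K ι P (fun i => BTensor.lift (f i) fun a t ht a' =>
    (hf i i t ht a a').symm) (DirectSum.lof K ι (fun i => BTensor (centralizerAt K A γ i) A A) i
      (BTensor.mk _ A A a a')) = _
  rw [DirectSum.toModule_lof, BTensor.lift_mk]

/-- Left multiplication by `b`. -/
def leftMul (b : A) : ComatrixCoring K A γ →ₗ[K] ComatrixCoring K A γ :=
  lift (fun i => (mk γ i).comp (LinearMap.mulLeft K b)) fun i j t ht a a' => by
    simp [mk_mul ht, mul_assoc]

/-- Right multiplication by `b`. -/
def rightMul (b : Aᵐᵒᵖ) : ComatrixCoring K A γ →ₗ[K] ComatrixCoring K A γ :=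
  lift (fun i => (mk γ i).compl₂ (LinearMap.mulRight K b.unop)) fun i j t ht a a' => by
    simp [mk_mul ht, mul_assoc]

/-- The left action `b (a ⊗ a') = b a ⊗ a'`. -/
instance : SMul A (ComatrixCoring K A γ) := ⟨fun b => leftMul b⟩

/-- The right action `(a ⊗ a') b = a ⊗ a' b`. -/
instance : SMul Aᵐᵒᵖ (ComatrixCoring K A γ) := ⟨fun b => rightMul b⟩

@[simp] theorem smul_mk (b : A) (i : ι) (a a' : A) :
    b • mk (K := K) γ i a a' = mk γ i (b * a) a' :=
  lift_mk _ _ _ _ _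

@[simp] theorem op_smul_mk (b : Aᵐᵒᵖ) (i : ι) (a a' : A) :
    b • mk (K := K) γ i a a' = mk γ i a (a' * b.unop) :=
  lift_mk _ _ _ _ _

@[simp] theorem leftMul_mk (b : A) (i : ι) (a a' : A) :
    leftMul b (mk (K := K) γ i a a') = mk γ i (b * a) a' :=
  lift_mk _ _ _ _ _

@[simp] theorem rightMul_mk (b : Aᵐᵒᵖ) (i : ι) (a a' : A) :
    rightMul b (mk (K := K) γ i a a') = mk γ i a (a' * b.unop) :=
  lift_mk _ _ _ _ _

instance : Module A (ComatrixCoring K A γ) where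
  smul_zero b := map_zero (leftMul b)
  smul_add b := map_add (leftMul b)
  one_smul := LinearMap.congr_fun (f := leftMul 1) (g := LinearMap.id) <| hom_ext <| by simp
  mul_smul b c := LinearMap.congr_fun (f := leftMul (b * c)) (g := leftMul b ∘ₗ leftMul c) <|
    hom_ext <| by simp [mul_assoc]
  add_smul b c := LinearMap.congr_fun (f := leftMul (b + c)) (g := leftMul b + leftMul c) <|
    hom_ext <| by simp [add_mul]
  zero_smul := LinearMap.congr_fun (f := leftMul 0) (g := 0) <| hom_ext <| by simp

instance : Module Aᵐᵒᵖ (ComatrixCoring K A γ) where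
  smul_zero b := map_zero (rightMul b)
  smul_add b := map_add (rightMul b)
  one_smul := LinearMap.congr_fun (f := rightMul 1) (g := LinearMap.id) <| hom_ext <| by simp
  mul_smul b c := LinearMap.congr_fun (f := rightMul (b * c)) (g := rightMul b ∘ₗ rightMul c) <|
    hom_ext <| by simp [mul_assoc]
  add_smul b c := LinearMap.congr_fun (f := rightMul (b + c)) (g := rightMul b + rightMul c) <|
    hom_ext <| by simp [mul_add]
  zero_smul := LinearMap.congr_fun (f := rightMul 0) (g := 0) <| hom_ext <| by simp

instance : SMulCommClass A Aᵐᵒᵖ (ComatrixCoring K A γ) := ⟨fun b c =>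
  LinearMap.congr_fun (f := leftMul b ∘ₗ rightMul c) (g := rightMul c ∘ₗ leftMul b) <|
    hom_ext <| by simp⟩

instance : IsScalarTower K A (ComatrixCoring K A γ) := ⟨fun k b x => by
  have h : leftMul (K := K) (γ := γ) (k • b) = k • leftMul b := hom_ext fun i a a' => by simp
  exact LinearMap.congr_fun h x⟩

instance : IsScalarTower K Aᵐᵒᵖ (ComatrixCoring K A γ) := ⟨fun k b x => by
  have h : rightMul (K := K) (γ := γ) (k • b) = k • rightMul b := hom_ext fun i a a' => by simp
  exact LinearMap.congr_fun h x⟩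

/-- The bimodule homomorphism on `ℜ(γ)` induced by a compatible family of bilinear maps. -/
def bimodHom {D : Type*} [AddCommGroup D] [Module K D] [Module A D] [Module Aᵐᵒᵖ D]
    [IsScalarTower K A D] [IsScalarTower K Aᵐᵒᵖ D] (f : ι → A →ₗ[K] A →ₗ[K] D)
    (hf : ∀ i j, ∀ t ∈ intertwiner K A γ i j, ∀ a a', f j a (t * a') = f i (a * t) a')
    (hl : ∀ b i a a', f i (b * a) a' = b • f i a a')
    (hr : ∀ b i a a', f i a (a' * b) = op b • f i a a') :
    BimodHom A (ComatrixCoring K A γ) D where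
  left :=
    { toFun := lift f hf
      map_add' := map_add (lift f hf)
      map_smul' := fun b x => by
        have h : lift f hf ∘ₗ leftMul b = (Algebra.lsmul K K D b : D →ₗ[K] D) ∘ₗ lift f hf :=
          hom_ext fun i a a' => by simp [hl]
        exact LinearMap.congr_fun h x }
  map_op_smul b x := by
    have h : lift f hf ∘ₗ rightMul b = (Algebra.lsmul K K D b : D →ₗ[K] D) ∘ₗ lift f hf :=
      hom_ext fun i a a' => by simp [hr]
    exact LinearMap.congr_fun h x

@[simp] theorem bimodHom_mk {D : Type*} [AddCommGroup D] [Module K D] [Module A D]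
    [Module Aᵐᵒᵖ D] [IsScalarTower K A D] [IsScalarTower K Aᵐᵒᵖ D]
    (f : ι → A →ₗ[K] A →ₗ[K] D)
    (hf : ∀ i j, ∀ t ∈ intertwiner K A γ i j, ∀ a a', f j a (t * a') = f i (a * t) a')
    (hl : ∀ b i a a', f i (b * a) a' = b • f i a a')
    (hr : ∀ b i a a', f i a (a' * b) = op b • f i a a') (i : ι) (a a' : A) :
    (bimodHom f hf hl hr).left (mk γ i a a') = f i a a' :=
  lift_mk f hf i a a'

theorem one_mk_mk_one {i j : ι} {t : A} (ht : t ∈ intertwiner K A γ i j) (a a' : A) :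
    BTensor.mk (⊤ : Subalgebra K A) _ _ (mk (K := K) γ j a 1) (mk (K := K) γ j 1 (t * a')) =
      BTensor.mk (⊤ : Subalgebra K A) _ _ (mk (K := K) γ i (a * t) 1) (mk (K := K) γ i 1 a') := by
  have h1 := mk_mul (K := K) ht a 1
  have h2 := mk_mul (K := K) ht 1 a'
  have h3 := BTensor.mk_smul (⊤ : Subalgebra K A) (mk (K := K) γ j a 1)
    (Algebra.mem_top (x := t)) (mk (K := K) γ i 1 a')
  simp only [smul_mk, op_smul_mk, unop_op, one_mul, mul_one] at h1 h2 h3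
  rw [h2, ← h1, h3]

variable (K γ) in
/-- The bilinear map `(a, a') ↦ (a ⊗ 1) ⊗_A (1 ⊗ a')`. -/
def comulBilin (i : ι) :
    A →ₗ[K] A →ₗ[K] TensorA K A (ComatrixCoring K A γ) (ComatrixCoring K A γ) :=
  (BTensor.mk (⊤ : Subalgebra K A) _ _).compl₁₂ ((mk γ i).flip 1) (mk γ i 1)

@[simp] theorem comulBilin_apply (i : ι) (a a' : A) :
    comulBilin K γ i a a' =
      BTensor.mk (⊤ : Subalgebra K A) _ _ (mk (K := K) γ i a 1) (mk (K := K) γ i 1 a') := rfl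

theorem comulBilin_compat (i j : ι) (t : A) (ht : t ∈ intertwiner K A γ i j) (a a' : A) :
    comulBilin K γ j a (t * a') = comulBilin K γ i (a * t) a' :=
  one_mk_mk_one ht a a'

theorem comulBilin_mul_left (b : A) (i : ι) (a a' : A) :
    comulBilin K γ i (b * a) a' = b • comulBilin K γ i a a' := by
  simp

theorem comulBilin_mul_right (b : A) (i : ι) (a a' : A) :
    comulBilin K γ i a (a' * b) = op b • comulBilin K γ i a a' := by
  simp

/-- The comultiplication `a ⊗ a' ↦ (a ⊗ 1) ⊗_A (1 ⊗ a')`. -/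
def comul : BimodHom A (ComatrixCoring K A γ)
    (TensorA K A (ComatrixCoring K A γ) (ComatrixCoring K A γ)) :=
  bimodHom (comulBilin K γ) comulBilin_compat comulBilin_mul_left comulBilin_mul_right

@[simp] theorem comul_mk (i : ι) (a a' : A) :
    (comul (K := K) (γ := γ)).left (mk γ i a a') =
      BTensor.mk ⊤ _ _ (mk γ i a 1) (mk γ i 1 a') := by
  rw [comul, bimodHom_mk, comulBilin_apply]

/-- The counit `a ⊗ a' ↦ a a'`. -/
def counit : BimodHom A (ComatrixCoring K A γ) A :=
  bimodHom (fun _ => LinearMap.mul K A) (fun i j t ht a a' => by simp [mul_assoc])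
    (fun b i a a' => by simp [mul_assoc])
    (fun b i a a' => by simp [mul_assoc])

@[simp] theorem counit_mk (i : ι) (a a' : A) :
    (counit (K := K) (γ := γ)).left (mk γ i a a') = a * a' := by
  simp [counit]

variable (γ) in
/-- The coring structure on `ℜ(γ)`, induced by those of the Sweedler corings
`A ⊗_{A_{i,i}} A`. -/
def coring : Coring K A (ComatrixCoring K A γ) where
  comul := comul
  counit := counit
  coassoc := LinearMap.congr_fun
    (f := TensorA.assoc _ _ _ ∘ₗ BTensor.map comul.right LinearMap.id ∘ₗ
      comul.left.restrictScalars K)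
    (g := BTensor.map LinearMap.id comul.left ∘ₗ comul.left.restrictScalars K) <|
    hom_ext <| by simp
  counit_comul := LinearMap.congr_fun
    (f := TensorA.lid _ ∘ₗ BTensor.map counit.right LinearMap.id ∘ₗ
      comul.left.restrictScalars K) (g := LinearMap.id) <|
    hom_ext <| by simp
  comul_counit := LinearMap.congr_fun
    (f := TensorA.rid _ ∘ₗ BTensor.map LinearMap.id counit.left ∘ₗ
      comul.left.restrictScalars K) (g := LinearMap.id) <|
    hom_ext <| by simp

variable (K γ) in
/-- The bilinear map `(a, a') ↦ a γ_i a'`. -/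
def canBilin (i : ι) : A →ₗ[K] A →ₗ[K] C :=
  LinearMap.mk₂ K (fun a a' => a • op a' • γ i) (fun _ _ _ => add_smul _ _ _)
    (fun _ _ _ => smul_assoc _ _ _)
    (fun a b b' => by rw [op_add, add_smul, smul_add])
    (fun k a b => by rw [op_smul, smul_assoc, smul_comm])

@[simp] theorem canBilin_apply (i : ι) (a a' : A) :
    canBilin K γ i a a' = a • op a' • γ i := rfl

theorem canBilin_compat (i j : ι) (t : A) (ht : t ∈ intertwiner K A γ i j) (a a' : A) :
    canBilin K γ j a (t * a') = canBilin K γ i (a * t) a' := by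
  have ht : op t • γ j = t • γ i := ht
  simp only [canBilin_apply, op_mul, mul_smul, ht]
  rw [smul_comm t]

theorem canBilin_mul_left (b : A) (i : ι) (a a' : A) :
    canBilin K γ i (b * a) a' = b • canBilin K γ i a a' := by
  simp [mul_smul]

theorem canBilin_mul_right (b : A) (i : ι) (a a' : A) :
    canBilin K γ i a (a' * b) = op b • canBilin K γ i a a' := by
  simp [mul_smul, smul_comm]

variable (K γ) in
/-- The canonical map `can : ℜ(γ) → C`, `a ⊗_{A_{i,i}} a' ↦ a γ_i a'`. -/
def can : BimodHom A (ComatrixCoring K A γ) C :=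
  bimodHom (canBilin K γ) canBilin_compat canBilin_mul_left canBilin_mul_right

@[simp] theorem can_mk (i : ι) (a a' : A) :
    (can K γ).left (mk γ i a a') = a • op a' • γ i := by
  rw [can, bimodHom_mk, canBilin_apply]

end ComatrixCoring

end GrouplikeCoring

open CategoryTheory CategoryTheory.Limits

/-! ### The category of right comodules over a coring -/

section Comodules

variable {K A C : Type*} [CommRing K] [Ring A] [Algebra K A] [AddCommGroup C]
    [Module K C] [Module A C] [Module Aᵐᵒᵖ C] [SMulCommClass A Aᵐᵒᵖ C] [IsScalarTower K A C]
    [IsScalarTower K Aᵐᵒᵖ C]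

/-- Right comodules over an `A`-coring. -/
structure RComod (𝒞 : Coring K A C) where
  carrier : Type w
  [addCommGroup : AddCommGroup carrier]
  [moduleBase : Module K carrier]
  [module : Module Aᵐᵒᵖ carrier]
  [tower : IsScalarTower K Aᵐᵒᵖ carrier]
  /-- The coaction `ρ : M → M ⊗_A C`. -/
  coact : carrier →ₗ[Aᵐᵒᵖ] TensorA K A carrier C
  coassoc : ∀ m, TensorA.assoc carrier C C (BTensor.map coact LinearMap.id (coact m)) =
    BTensor.map LinearMap.id 𝒞.comul.left (coact m)
  coact_counit : ∀ m, TensorA.rid carrier (BTensor.map LinearMap.id 𝒞.counit.left (coact m)) = m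

namespace RComod

variable {𝒞 : Coring K A C}

attribute [instance] RComod.addCommGroup RComod.moduleBase RComod.module RComod.tower

/-- Morphisms of right comodules. -/
@[ext]
structure Hom (M N : RComod.{w} 𝒞) where
  toLin : M.carrier →ₗ[Aᵐᵒᵖ] N.carrier
  comm : ∀ m, BTensor.map toLin LinearMap.id (M.coact m) = N.coact (toLin m)

instance : Category (RComod.{w} 𝒞) where
  Hom := Hom
  id M :=
    { toLin := LinearMap.id
      comm := by
        have h : BTensor.map (B := (⊤ : Subalgebra K A)) (LinearMap.id (M := M.carrier))
            (LinearMap.id (M := C)) = LinearMap.id := BTensor.hom_ext fun m c => by simp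
        exact fun m => LinearMap.congr_fun h _ }
  comp {L M N} f g :=
    { toLin := g.toLin ∘ₗ f.toLin
      comm := by
        have h : BTensor.map (B := (⊤ : Subalgebra K A)) (g.toLin ∘ₗ f.toLin)
            (LinearMap.id (M := C)) =
              BTensor.map g.toLin LinearMap.id ∘ₗ BTensor.map f.toLin LinearMap.id :=
          BTensor.hom_ext fun m c => by simp
        intro m
        rw [h, LinearMap.comp_apply, f.comm, g.comm, LinearMap.comp_apply] }

variable (𝒞) in
/-- The forgetful functor to right `A`-modules. -/
def forget : RComod.{w} 𝒞 ⥤ ModuleCat.{w} Aᵐᵒᵖ where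
  obj M := ModuleCat.of Aᵐᵒᵖ M.carrier
  map f := ModuleCat.ofHom (Hom.toLin f)

end RComod

end Comodules

section GrouplikeComodule

variable {K : Type v} {A : Type u} {C : Type w} [CommRing K] [Ring A] [Algebra K A]
    [AddCommGroup C] [Module K C] [Module A C] [Module Aᵐᵒᵖ C] [SMulCommClass A Aᵐᵒᵖ C]
    [IsScalarTower K A C] [IsScalarTower K Aᵐᵒᵖ C]

/-- The right comodule `[g]A` of a grouplike element `g`: the right `A`-module `A` with
coaction `a ↦ 1 ⊗ g a`. -/
def Coring.IsGrouplike.comodule {𝒞 : Coring K A C} {g : C} (hg : 𝒞.IsGrouplike g) :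
    RComod.{u} 𝒞 where
  carrier := A
  coact :=
    { toFun := fun a => BTensor.mk ⊤ A C 1 (op a • g)
      map_add' := fun a b => by simp [add_smul]
      map_smul' := fun r a => by simp [mul_smul] }
  coassoc a := by
    have h1 := 𝒞.comul.map_op_smul (op a) g
    rw [hg.comul_eq] at h1
    simp [h1]
  coact_counit a := by
    have h1 := 𝒞.counit.map_op_smul (op a) g
    rw [hg.counit_eq] at h1
    simp [h1]

end GrouplikeComodule

/-! ### The coring of a graded algebra -/

section Graded

variable {K : Type v} {A : Type u} {G : Type u} [CommRing K] [Ring A] [Algebra K A] [Group G]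
    [DecidableEq G] (𝒜 : Additive G → Submodule K A) [GradedAlgebra 𝒜]

/-- The algebra map `A → A[G]`, `a ↦ ∑_h a_h h`, where `a_h` is the component of degree `h`. -/
def gradingMap : A →ₐ[K] MonoidAlgebra A G :=
  (DirectSum.toAlgebra K (fun i => 𝒜 i)
    (fun h => (MonoidAlgebra.lsingle (R := K) (S := A) h.toMul) ∘ₗ (𝒜 h).subtype)
    (by simp [MonoidAlgebra.one_def])
    (by intro i j a b; simp [MonoidAlgebra.single_mul_single])).comp
  (DirectSum.decomposeAlgEquiv 𝒜).toAlgHom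

theorem gradingMap_of_mem {h : G} {a : A} (ha : a ∈ 𝒜 (Additive.ofMul h)) :
    gradingMap 𝒜 a = MonoidAlgebra.single h a := by
  change DirectSum.toModule K (Additive G) (MonoidAlgebra A G) _ (DirectSum.decompose 𝒜 a) = _
  rw [DirectSum.decompose_of_mem 𝒜 ha]
  exact DirectSum.toModule_lof (M := fun i => 𝒜 i) K (Additive.ofMul h) ⟨a, ha⟩

/-- The free left `A`-module `AG` with basis `G`. -/
def GroupCoring (_ : Additive G → Submodule K A) : Type u := MonoidAlgebra A G

namespace GroupCoring

instance : AddCommGroup (GroupCoring 𝒜) := inferInstanceAs (AddCommGroup (MonoidAlgebra A G))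

instance : Module K (GroupCoring 𝒜) := inferInstanceAs (Module K (MonoidAlgebra A G))

instance : Module A (GroupCoring 𝒜) := inferInstanceAs (Module A (MonoidAlgebra A G))

instance : IsScalarTower K A (GroupCoring 𝒜) :=
  inferInstanceAs (IsScalarTower K A (MonoidAlgebra A G))

/-- The right action of `A` on `AG`: the product with `∑_h a_h h` in `A[G]`, so that
`(b g) a = (b a) (g h)` for `a` homogeneous of degree `h`. -/
instance : Module Aᵐᵒᵖ (GroupCoring 𝒜) :=
  Module.compHom (MonoidAlgebra A G) (R := (MonoidAlgebra A G)ᵐᵒᵖ)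
    (RingHom.op (gradingMap 𝒜).toRingHom)

/-- The identity map `AG → A[G]`. -/
def toMonoidAlgebra : GroupCoring 𝒜 ≃ₗ[A] MonoidAlgebra A G := LinearEquiv.refl A _

theorem toMonoidAlgebra_op_smul (r : Aᵐᵒᵖ) (x : GroupCoring 𝒜) :
    toMonoidAlgebra 𝒜 (r • x) = toMonoidAlgebra 𝒜 x * gradingMap 𝒜 r.unop := rfl

theorem toMonoidAlgebra_smul_base (k : K) (x : GroupCoring 𝒜) :
    toMonoidAlgebra 𝒜 (k • x) = k • toMonoidAlgebra 𝒜 x := rfl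

instance : SMulCommClass A Aᵐᵒᵖ (GroupCoring 𝒜) := ⟨fun a r x =>
  (toMonoidAlgebra 𝒜).injective <| by
    rw [map_smul, toMonoidAlgebra_op_smul, toMonoidAlgebra_op_smul, map_smul, smul_mul_assoc]⟩

instance : IsScalarTower K Aᵐᵒᵖ (GroupCoring 𝒜) := ⟨fun k r x =>
  (toMonoidAlgebra 𝒜).injective <| by
    rw [toMonoidAlgebra_smul_base, toMonoidAlgebra_op_smul, toMonoidAlgebra_op_smul, unop_smul,
      map_smul, mul_smul_comm]⟩

/-- The basis element `g` of `AG`. -/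
def of (g : G) : GroupCoring 𝒜 := MonoidAlgebra.single g (1 : A)

/-- The right action: `g a = a (g h)` for `a` homogeneous of degree `h`. -/
theorem op_smul_of {h : G} {a : A} (ha : a ∈ 𝒜 (Additive.ofMul h)) (g : G) :
    op a • of 𝒜 g = a • of 𝒜 (g * h) := by
  change MonoidAlgebra.single g (1 : A) * gradingMap 𝒜 a =
    a • MonoidAlgebra.single (g * h) (1 : A)
  rw [gradingMap_of_mem 𝒜 ha, MonoidAlgebra.single_mul_single]
  simp

/-- The left `A`-linear map on `AG` with prescribed values on the basis `G`. -/
def lift {D : Type*} [AddCommGroup D] [Module A D] (f : G → D) : GroupCoring 𝒜 →ₗ[A] D :=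
  (Finsupp.linearCombination A f) ∘ₗ
    (MonoidAlgebra.coeffLinearEquiv (S := A) (M := G) A).toLinearMap

@[simp] theorem lift_of {D : Type*} [AddCommGroup D] [Module A D] (f : G → D) (g : G) :
    lift 𝒜 f (of 𝒜 g) = f g := by
  change Finsupp.linearCombination A f (Finsupp.single g (1 : A)) = _
  simp

variable {𝒜} in
theorem induction {p : GroupCoring 𝒜 → Prop} (x : GroupCoring 𝒜) (zero : p 0)
    (add : ∀ x y, p x → p y → p (x + y)) (smul_of : ∀ (a : A) (g : G), p (a • of 𝒜 g)) : p x := by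
  refine MonoidAlgebra.induction_linear (motive := p) x zero (fun x y => add x y) fun g a => ?_
  have h : (a • of 𝒜 g : GroupCoring 𝒜) = MonoidAlgebra.single g a := by
    change a • MonoidAlgebra.single g (1 : A) = _
    simp
  exact h ▸ smul_of a g

variable {𝒜} in
theorem hom_ext {D : Type*} [AddCommGroup D] [Module A D] {f f' : GroupCoring 𝒜 →ₗ[A] D}
    (h : ∀ g, f (of 𝒜 g) = f' (of 𝒜 g)) : f = f' := by
  ext x
  induction x using induction with
  | zero => simp
  | add x y hx hy => simp [hx, hy]
  | smul_of a g => simp [h]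

/-- A left linear map on `AG` which respects the right action on basis elements is a bimodule
homomorphism. -/
def bimodHom {D : Type*} [AddCommGroup D] [Module A D] [Module Aᵐᵒᵖ D] [SMulCommClass A Aᵐᵒᵖ D]
    (f : G → D) (hf : ∀ g h a, a ∈ 𝒜 (Additive.ofMul h) → a • f (g * h) = op a • f g) :
    BimodHom A (GroupCoring 𝒜) D where
  left := lift 𝒜 f
  map_op_smul r x := by
    induction x using induction with
    | zero => simp
    | add x y hx hy => simp [hx, hy]
    | smul_of b g =>
      rw [← smul_comm b r (of 𝒜 g), map_smul (lift 𝒜 f) b, map_smul (lift 𝒜 f) b,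
        ← smul_comm b r (lift 𝒜 f (of 𝒜 g))]
      congr 1
      induction r using MulOpposite.rec' with | _ a => ?_
      induction a using DirectSum.Decomposition.inductionOn 𝒜 with
      | zero => simp
      | add a b ha hb => rw [MulOpposite.op_add, add_smul, add_smul, map_add, ha, hb]
      | @homogeneous h a => rw [op_smul_of 𝒜 (h := h.toMul) a.2, map_smul, lift_of, lift_of,
          hf g h.toMul a a.2]

@[simp] theorem bimodHom_left_of {D : Type*} [AddCommGroup D] [Module A D] [Module Aᵐᵒᵖ D]
    [SMulCommClass A Aᵐᵒᵖ D] (f : G → D)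
    (hf : ∀ g h a, a ∈ 𝒜 (Additive.ofMul h) → a • f (g * h) = op a • f g) (g : G) :
    (bimodHom 𝒜 f hf).left (of 𝒜 g) = f g :=
  lift_of 𝒜 f g

/-- The coring structure on `AG`: `Δ(a g) = a g ⊗_A g` and `ε(a g) = a`. -/
def coring : Coring K A (GroupCoring 𝒜) where
  comul := bimodHom 𝒜 (fun g => BTensor.mk ⊤ _ _ (of 𝒜 g) (of 𝒜 g)) fun g h a ha => by
    rw [BTensor.smul_mk, ← op_smul_of 𝒜 ha, BTensor.op_smul_mk,
      BTensor.mk_smul _ _ Algebra.mem_top, op_smul_of 𝒜 ha]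
  counit := bimodHom 𝒜 (fun _ => 1) fun g h a ha => by simp
  coassoc c := by
    induction c using induction with
    | zero => simp
    | add x y hx hy => simp only [map_add, hx, hy]
    | smul_of a g => simp
  counit_comul c := by
    induction c using induction with
    | zero => simp
    | add x y hx hy => simp only [map_add, hx, hy]
    | smul_of a g => simp
  comul_counit c := by
    induction c using induction with
    | zero => simp
    | add x y hx hy => simp only [map_add, hx, hy]
    | smul_of a g => simp

theorem isGrouplike_of (g : G) : (coring 𝒜).IsGrouplike (of 𝒜 g) :=
  ⟨lift_of 𝒜 _ g, lift_of 𝒜 _ g⟩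

end GroupCoring

/-! ### Graded modules -/

/-- `G`-graded right `A`-modules. -/
structure GrMod where
  carrier : Type w
  [addCommGroup : AddCommGroup carrier]
  [moduleBase : Module K carrier]
  [module : Module Aᵐᵒᵖ carrier]
  [tower : IsScalarTower K Aᵐᵒᵖ carrier]
  /-- The homogeneous components. -/
  grading : G → Submodule K carrier
  isInternal : DirectSum.IsInternal grading
  smul_mem : ∀ {g h : G} {m : carrier} {a : A}, m ∈ grading g → a ∈ 𝒜 (Additive.ofMul h) →
    op a • m ∈ grading (g * h)

namespace GrMod

attribute [instance] GrMod.addCommGroup GrMod.moduleBase GrMod.module GrMod.tower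

variable {𝒜}

/-- Morphisms of graded modules: the linear maps which preserve degrees. -/
@[ext]
structure Hom (M N : GrMod.{u, v, w} 𝒜) where
  toLin : M.carrier →ₗ[Aᵐᵒᵖ] N.carrier
  map_mem : ∀ g, ∀ m ∈ M.grading g, toLin m ∈ N.grading g

instance : Category (GrMod.{u, v, w} 𝒜) where
  Hom := Hom
  id M := ⟨LinearMap.id, fun _ _ h => h⟩
  comp f g := ⟨g.toLin ∘ₗ f.toLin, fun x m h => g.map_mem x _ (f.map_mem x m h)⟩

variable (𝒜)

/-- The forgetful functor to right `A`-modules. -/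
def forget : GrMod.{u, v, w} 𝒜 ⥤ ModuleCat.{w} Aᵐᵒᵖ where
  obj M := ModuleCat.of Aᵐᵒᵖ M.carrier
  map f := ModuleCat.ofHom (Hom.toLin f)

/-- The shift of the graded module `A` in which `A_{g⁻¹ x}` is the component of degree `x`. -/
def shift (g : G) : GrMod.{u, v, u} 𝒜 where
  carrier := A
  grading x := 𝒜 (Additive.ofMul (g⁻¹ * x))
  isInternal := by
    have h := (DirectSum.isInternal_submodule_iff_iSupIndep_and_iSup_eq_top 𝒜).1
      (DirectSum.Decomposition.isInternal 𝒜)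
    refine (DirectSum.isInternal_submodule_iff_iSupIndep_and_iSup_eq_top _).2 ⟨?_, ?_⟩
    · exact h.1.comp (f := fun x : G => Additive.ofMul (g⁻¹ * x))
        fun x y hxy => mul_left_cancel (Additive.ofMul.injective hxy)
    · rw [← h.2]
      exact ((Equiv.mulLeft g⁻¹).trans Additive.ofMul).iSup_comp (g := 𝒜)
  smul_mem {x y m a} hm ha := by
    have h := SetLike.mul_mem_graded hm ha
    rwa [← ofMul_mul, mul_assoc] at h

variable {𝒜} in
/-- The direct sum of a family of graded modules, with the componentwise grading. -/
def directSum {ι : Type u} (M : ι → GrMod.{u, v, u} 𝒜) : GrMod.{u, v, u} 𝒜 where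
  carrier := ⨁ i, (M i).carrier
  grading x :=
    { carrier := {f | ∀ i, f i ∈ (M i).grading x}
      zero_mem' := fun i => zero_mem _
      add_mem' := fun hf hg i => add_mem (hf i) (hg i)
      smul_mem' := fun k f hf i => Submodule.smul_mem _ k (hf i) }
  isInternal := by
    classical
    refine (DirectSum.isInternal_submodule_iff_iSupIndep_and_iSup_eq_top _).2 ⟨?_, ?_⟩
    · intro x
      rw [Submodule.disjoint_def]
      intro f hf hf'
      ext i
      have hi := (DirectSum.isInternal_submodule_iff_iSupIndep_and_iSup_eq_top _).1
        (M i).isInternal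
      refine (Submodule.disjoint_def.1 (hi.1 x)) (f i) (hf i) ?_
      have hle : (⨆ (j) (_ : j ≠ x), ({
          carrier := {f | ∀ i, f i ∈ (M i).grading j}
          zero_mem' := fun i => zero_mem _
          add_mem' := fun hf hg i => add_mem (hf i) (hg i)
          smul_mem' := fun k f hf i => Submodule.smul_mem _ k (hf i) } :
            Submodule K (⨁ i, (M i).carrier))) ≤
          (⨆ (j) (_ : j ≠ x), (M i).grading j).comap
            (DirectSum.component K ι (fun i => (M i).carrier) i) :=
        iSup₂_le fun j hj f hf => Submodule.mem_iSup_of_mem j (Submodule.mem_iSup_of_mem hj (hf i))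
      exact hle hf'
    · rw [eq_top_iff]
      rintro f -
      induction f using DirectSum.induction_on with
      | zero => exact zero_mem _
      | add f g hf hg => exact add_mem hf hg
      | of i m =>
        have hi := (DirectSum.isInternal_submodule_iff_iSupIndep_and_iSup_eq_top _).1
          (M i).isInternal
        have hm : m ∈ ⨆ x, (M i).grading x := hi.2 ▸ Submodule.mem_top
        induction hm using Submodule.iSup_induction' with
        | zero => rw [map_zero]; exact zero_mem _
        | add m m' _ _ h h' => rw [map_add]; exact add_mem h h'
        | mem x m hm =>
          refine Submodule.mem_iSup_of_mem x fun j => ?_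
          by_cases hj : i = j
          · subst hj
            rw [DirectSum.of_eq_same]
            exact hm
          · rw [DirectSum.of_eq_of_ne _ _ _ (Ne.symm hj)]
            exact zero_mem _
  smul_mem hf ha i := (M i).smul_mem (hf i) ha

end GrMod

end Graded

/-- Small objects: every morphism to a coproduct factors through a finite subcoproduct. -/
def IsSmallObj {C : Type*} [Category.{u} C] (P : C) : Prop :=
  ∀ (ι : Type u) (M : ι → C) (c : Cofan M) (_ : IsColimit c) (f : P ⟶ c.pt),
    ∃ (s : Finset ι) (d : Cofan fun i : s => M i) (hd : IsColimit d) (f' : P ⟶ d.pt),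
      f' ≫ Cofan.IsColimit.desc hd (fun i => c.inj i) = f

end

open CategoryTheory

noncomputable section

set_option linter.unusedSectionVars false

open CategoryTheory CategoryTheory.Limits

/-! The tensor product `M ⊗_A AG` splits as `⨁_g M ⊗ g`, because `AG` is free over `A` on `G`. A
coaction on `M` is therefore a family of additive maps `m ↦ m_g`, almost all zero at each `m`.
Coassociativity says that `m_g` coacts as `m_g ⊗ g`, the counit axiom says that `m = ∑ m_g`, and
right linearity says that `A_h` moves degree `g` to degree `g h`. This is exactly a grading, and the
inverse construction is `m ↦ ∑ m_g ⊗ g`. Both constructions keep the underlying module, so the two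
categories are isomorphic and not only equivalent. The lemmas that carry this are
`tensorCoeff_coact_mem`, `isInternal_component` and `mem_grading_of_gradedCoact`.

Morphisms from the shift `[g]A` to `M` correspond to elements of `M` of degree `g`, through the
image of `1`. Homogeneous elements span, so the shifts separate morphisms. A homogeneous element
lifts along a surjection to one of the same degree, and epimorphisms are surjective, so the shifts
are projective. An element of a direct sum has finite support, so they are small.

For a family `γ` in `G`, write `γ_i` for its members. The canonical map is bijective once `1` is,
for every `g`, a finite sum of products `b c` with `b` of degree `g⁻¹ γ_i` and `c` of degree `γ_i⁻¹
g`. The inverse then sends the basis element `g` to the class of `∑ b ⊗ c`, and the relations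
defining `ℜ` make this a two-sided inverse (`exists_can_eq`, `bijective_can`). For the family of all
of `G` the single product `1 · 1` is enough. For a generator `⨁ [γ_i]A`, the submodule of `[g]A`
generated by its components of degrees `γ_i` contains every image of the generator. It is therefore
all of `[g]A`, and the component of degree `g` of an expression of `1` has the required form
(`one_mem_traceAt`). -/

/-- A family of submodules which admits projections and which spans is a direct sum
decomposition. -/
theorem isInternal_of_proj {K G M : Type*} [CommRing K] [DecidableEq G] [AddCommGroup M]
    [Module K M] {S : G → Submodule K M} (p : G → M →ₗ[K] M)
    (hp : ∀ g, ∀ m ∈ S g, p g m = m) (hp' : ∀ g h, h ≠ g → ∀ m ∈ S h, p g m = 0)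
    (hS : ⨆ g, S g = ⊤) : DirectSum.IsInternal S := by
  refine (DirectSum.isInternal_submodule_iff_iSupIndep_and_iSup_eq_top _).2 ⟨fun g => ?_, hS⟩
  rw [Submodule.disjoint_def]
  intro m hm hm'
  -- Independence: `p g` kills the sum of the other submodules and fixes `S g`, so the two meet only
  -- in zero.
  have hle : (⨆ (h) (_ : h ≠ g), S h) ≤ LinearMap.ker (p g) :=
    iSup₂_le fun h hh m hm => hp' g h hh m hm
  rw [← hp g m hm]
  exact hle hm'

namespace GrMod

variable {K : Type v} {A : Type u} {G : Type u} [CommRing K] [Ring A] [Algebra K A] [Group G]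
    [DecidableEq G] {𝒜 : Additive G → Submodule K A} [GradedAlgebra 𝒜]

/-! ### Homogeneous components of a graded module -/

section Components

/-- A graded module is the external direct sum of its components. -/
def decompose (M : GrMod.{u, v, w} 𝒜) : M.carrier ≃ₗ[K] ⨁ g, M.grading g :=
  (LinearEquiv.ofBijective (DirectSum.coeLinearMap M.grading) M.isInternal).symm

theorem decompose_of_mem (M : GrMod.{u, v, w} 𝒜) {g : G} {m : M.carrier}
    (hm : m ∈ M.grading g) :
    M.decompose m = DirectSum.lof K G (fun g => M.grading g) g ⟨m, hm⟩ := by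
  rw [decompose, LinearEquiv.symm_apply_eq]
  exact (DirectSum.coeLinearMap_lof M.grading g ⟨m, hm⟩).symm

/-- The projection to the component of degree `g`. -/
def comp (M : GrMod.{u, v, w} 𝒜) (g : G) : M.carrier →ₗ[K] M.carrier :=
  (M.grading g).subtype ∘ₗ DirectSum.component K G (fun g => M.grading g) g ∘ₗ
    M.decompose.toLinearMap

theorem comp_mem (M : GrMod.{u, v, w} 𝒜) (g : G) (m : M.carrier) :
    M.comp g m ∈ M.grading g :=
  Subtype.property _

theorem comp_of_mem (M : GrMod.{u, v, w} 𝒜) {g : G} {m : M.carrier} (hm : m ∈ M.grading g) :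
    M.comp g m = m := by
  simp [comp, M.decompose_of_mem hm, DirectSum.component.lof_self]

theorem comp_of_mem_ne (M : GrMod.{u, v, w} 𝒜) {g h : G} {m : M.carrier}
    (hm : m ∈ M.grading h) (hgh : h ≠ g) : M.comp g m = 0 := by
  simp [comp, M.decompose_of_mem hm, DirectSum.component.of, hgh]

theorem iSup_grading (M : GrMod.{u, v, w} 𝒜) : ⨆ g, M.grading g = ⊤ :=
  ((DirectSum.isInternal_submodule_iff_iSupIndep_and_iSup_eq_top _).1 M.isInternal).2

theorem homogeneous_induction (M : GrMod.{u, v, w} 𝒜) {p : M.carrier → Prop} (m : M.carrier)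
    (zero : p 0) (add : ∀ m n, p m → p n → p (m + n))
    (mem : ∀ g, ∀ m ∈ M.grading g, p m) : p m := by
  have hm : m ∈ ⨆ g, M.grading g := M.iSup_grading ▸ Submodule.mem_top
  induction hm using Submodule.iSup_induction' with
  | zero => exact zero
  | add m n _ _ h h' => exact add m n h h'
  | mem g m hm => exact mem g m hm

/-- Right translation by `h` is injective on degrees, so multiplication by `a` cannot bring a
component of another degree into degree `g h`. -/
theorem comp_op_smul (M : GrMod.{u, v, w} 𝒜) {h : G} {a : A} (ha : a ∈ 𝒜 (Additive.ofMul h))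
    (g : G) (m : M.carrier) : M.comp (g * h) (op a • m) = op a • M.comp g m := by
  induction m using M.homogeneous_induction with
  | zero => simp
  | add m n hm hn => simp [hm, hn]
  | mem x m hm =>
    by_cases hx : x = g
    · subst hx
      rw [M.comp_of_mem hm, M.comp_of_mem (M.smul_mem hm ha)]
    · rw [M.comp_of_mem_ne hm hx, smul_zero,
        M.comp_of_mem_ne (M.smul_mem hm ha) fun e => hx (mul_right_cancel e)]

theorem Hom.map_comp {M N : GrMod.{u, v, w} 𝒜} (f : Hom M N) (g : G) (m : M.carrier) :
    f.toLin (M.comp g m) = N.comp g (f.toLin m) := by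
  induction m using M.homogeneous_induction with
  | zero => simp
  | add m n hm hn => simp [hm, hn]
  | mem x m hm =>
    by_cases hx : x = g
    · subst hx
      rw [M.comp_of_mem hm, N.comp_of_mem (f.map_mem _ _ hm)]
    · rw [M.comp_of_mem_ne hm hx, N.comp_of_mem_ne (f.map_mem _ _ hm) hx, map_zero]

/-- Morphisms of graded modules which agree on homogeneous elements are equal. -/
theorem hom_ext_mem {M N : GrMod.{u, v, w} 𝒜} {f f' : M ⟶ N}
    (h : ∀ g, ∀ m ∈ M.grading g, Hom.toLin f m = Hom.toLin f' m) : f = f' := by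
  refine Hom.ext (LinearMap.ext fun m => ?_)
  induction m using M.homogeneous_induction with
  | zero => simp
  | add m n hm hn => rw [map_add, map_add, hm, hn]
  | mem x m hm => exact h x m hm

end Components

/-! ### Shifts of `A` represent the homogeneous components -/

section Shift

/-- The morphism `a ↦ m a` from a shift of `A` to `M`, for `m` homogeneous in `M`. -/
def homOfMem (M : GrMod.{u, v, u} 𝒜) {g : G} {m : M.carrier} (hm : m ∈ M.grading g) :
    shift 𝒜 g ⟶ M :=
  Hom.mk (M := shift 𝒜 g)
    { toFun := fun a : A => op a • m
      map_add' := @fun (a b : A) => add_smul (op a) (op b) m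
      map_smul' := fun r a => mul_smul r (op a) m }
    fun x a ha => by
      have := M.smul_mem hm (h := g⁻¹ * x) ha
      rwa [mul_inv_cancel_left] at this

theorem one_mem_shift (g : G) : (1 : A) ∈ (shift 𝒜 g).grading g := by
  change (1 : A) ∈ 𝒜 (Additive.ofMul (g⁻¹ * g))
  rw [inv_mul_cancel]
  exact SetLike.GradedOne.one_mem (A := 𝒜)

theorem shift_hom_apply {M : GrMod.{u, v, u} 𝒜} {g : G} (f : shift 𝒜 g ⟶ M) (a : A) :
    Hom.toLin f a = op a • Hom.toLin f (1 : A) := by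
  have h := (Hom.toLin f).map_smul (op a) (1 : A)
  have h1 : (op a • (1 : A)) = a := by simp
  exact (congrArg (Hom.toLin f) h1.symm).trans h

/-- A morphism from a shift of `A` is determined by the image of `1`. -/
theorem shift_hom_ext {M : GrMod.{u, v, u} 𝒜} {g : G} {f f' : shift 𝒜 g ⟶ M}
    (h : Hom.toLin f (1 : A) = Hom.toLin f' (1 : A)) : f = f' :=
  Hom.ext (LinearMap.ext fun a : A =>
    (shift_hom_apply f a).trans ((congrArg (op a • ·) h).trans (shift_hom_apply f' a).symm))

/-- Each homogeneous element of degree `g` is the image of `1` under a morphism from `[g]A`, so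
morphisms that agree after composition with these agree on all homogeneous elements. -/
theorem isSeparating_shift : (ObjectProperty.ofObj (shift 𝒜)).IsSeparating := by
  intro X Y f f' h
  refine hom_ext_mem fun g m hm => ?_
  have h1 := h _ ⟨g⟩ (homOfMem X hm)
  have h2 := congrArg (fun φ : shift 𝒜 g ⟶ Y => Hom.toLin φ (1 : A)) h1
  change Hom.toLin f (op (1 : A) • m) = Hom.toLin f' (op (1 : A) • m) at h2
  simpa using h2

end Shift

/-! ### Graded quotients, surjectivity of epimorphisms, projectivity of the shifts -/

section Quotient

/-- A submodule generated by homogeneous elements is graded. This allows the quotient by the trace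
submodule to be formed among graded modules. -/
theorem comp_mem_span (M : GrMod.{u, v, w} 𝒜) {s : Set M.carrier}
    (hs : ∀ m ∈ s, ∃ g, m ∈ M.grading g) {m : M.carrier} (hm : m ∈ Submodule.span Aᵐᵒᵖ s)
    (g : G) : M.comp g m ∈ Submodule.span Aᵐᵒᵖ s := by
  induction hm using Submodule.span_induction generalizing g with
  | zero => simp
  | add m n _ _ hm hn => rw [map_add]; exact add_mem (hm g) (hn g)
  | mem m hm =>
    obtain ⟨x, hx⟩ := hs m hm
    by_cases h : x = g
    · subst h
      rw [M.comp_of_mem hx]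
      exact Submodule.subset_span hm
    · rw [M.comp_of_mem_ne hx h]
      exact zero_mem _
  | smul r m _ hm =>
    induction r using MulOpposite.rec' with | _ a => ?_
    induction a using DirectSum.Decomposition.inductionOn 𝒜 with
    | zero => simp
    | add a b ha hb => rw [MulOpposite.op_add, add_smul, map_add]; exact add_mem ha hb
    | @homogeneous h a =>
      -- The component of degree `g` of `m a` comes from the component of degree `g h⁻¹` of `m`,
      -- which is why the induction hypothesis is kept for all degrees.
      have := M.comp_op_smul (h := h.toMul) a.2 (g * h.toMul⁻¹) m
      rw [inv_mul_cancel_right] at this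
      rw [this]
      exact Submodule.smul_mem _ _ (hm _)

/-- The quotient of a graded module by a submodule which is closed under taking components. -/
def quotient (M : GrMod.{u, v, w} 𝒜) (N : Submodule Aᵐᵒᵖ M.carrier)
    (hN : ∀ m ∈ N, ∀ g, M.comp g m ∈ N) : GrMod.{u, v, w} 𝒜 where
  carrier := M.carrier ⧸ N
  grading g := (M.grading g).map (N.mkQ.restrictScalars K)
  isInternal := by
    refine isInternal_of_proj
      (fun g => (N.restrictScalars K).mapQ (N.restrictScalars K) (M.comp g) fun m hm => hN m hm g)
      ?_ ?_ ?_
    · rintro g _ ⟨m, hm, rfl⟩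
      exact congrArg N.mkQ (M.comp_of_mem hm)
    · rintro g h hgh _ ⟨m, hm, rfl⟩
      exact (congrArg N.mkQ (M.comp_of_mem_ne hm hgh)).trans (map_zero _)
    · rw [← Submodule.map_iSup, M.iSup_grading, Submodule.map_top, LinearMap.range_eq_top]
      exact N.mkQ_surjective
  smul_mem := by
    rintro g h _ a ⟨m, hm, rfl⟩ ha
    exact ⟨op a • m, M.smul_mem hm ha, rfl⟩

/-- The projection to the quotient. -/
def quotientMk (M : GrMod.{u, v, w} 𝒜) (N : Submodule Aᵐᵒᵖ M.carrier)
    (hN : ∀ m ∈ N, ∀ g, M.comp g m ∈ N) : M ⟶ M.quotient N hN :=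
  Hom.mk (N := M.quotient N hN) N.mkQ fun _ m hm => ⟨m, hm, rfl⟩

/-- The zero morphism. -/
def zeroHom (M N : GrMod.{u, v, w} 𝒜) : M ⟶ N := Hom.mk 0 fun _ _ _ => zero_mem _

/-- Turns a cancellation property into a generation statement. It is applied to the image of an
epimorphism and to the trace submodule of a generator. -/
theorem eq_top_of_quotientMk_eq_zeroHom (M : GrMod.{u, v, w} 𝒜) (N : Submodule Aᵐᵒᵖ M.carrier)
    (hN : ∀ m ∈ N, ∀ g, M.comp g m ∈ N) (h : quotientMk M N hN = zeroHom _ _) : N = ⊤ := by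
  have h1 : N.mkQ = 0 := congrArg Hom.toLin h
  rw [← N.ker_mkQ, h1, LinearMap.ker_zero]

/-- The image of a graded morphism is a graded submodule. The projection modulo the image and the
zero morphism agree after `e`, hence are equal. -/
theorem surjective_of_epi {M N : GrMod.{u, v, w} 𝒜} (e : M ⟶ N) [Epi e] :
    Function.Surjective (Hom.toLin e) := by
  have hN : ∀ n ∈ LinearMap.range (Hom.toLin e), ∀ g,
      N.comp g n ∈ LinearMap.range (Hom.toLin e) := by
    rintro _ ⟨m, rfl⟩ g
    exact ⟨M.comp g m, Hom.map_comp e g m⟩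
  rw [← LinearMap.range_eq_top]
  refine N.eq_top_of_quotientMk_eq_zeroHom _ hN ((cancel_epi e).1 (Hom.ext ?_))
  exact LinearMap.ext fun m => (Submodule.Quotient.mk_eq_zero _).2 ⟨m, rfl⟩

/-- Any preimage of the image of `1` can be replaced by its component of degree `g`: that image is
itself of degree `g`, and morphisms commute with taking components. -/
theorem projective_shift (g : G) : Projective (shift 𝒜 g) where
  factors {E X} f e _ := by
    obtain ⟨m, hm⟩ := surjective_of_epi e (Hom.toLin f (1 : A))
    refine ⟨homOfMem E (E.comp_mem g m), shift_hom_ext ?_⟩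
    change Hom.toLin e (op (1 : A) • E.comp g m) = _
    rw [op_one, one_smul, Hom.map_comp, hm]
    exact X.comp_of_mem (f.map_mem g _ (one_mem_shift (𝒜 := 𝒜) g))

end Quotient

/-! ### Direct sums as coproducts, smallness of the shifts -/

section Coproducts

variable {ι : Type u} (M : ι → GrMod.{u, v, u} 𝒜)

open scoped Classical in
theorem lof_mem_grading {i : ι} {g : G} {m : (M i).carrier} (hm : m ∈ (M i).grading g) (j : ι) :
    DirectSum.lof Aᵐᵒᵖ ι (fun i => (M i).carrier) i m j ∈ (M j).grading g := by
  by_cases hj : i = j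
  · subst hj
    rw [DirectSum.lof_eq_of, DirectSum.of_eq_same]
    exact hm
  · rw [DirectSum.lof_eq_of, DirectSum.of_eq_of_ne _ _ _ (Ne.symm hj)]
    exact zero_mem _

open scoped Classical in
theorem toModule_mem_grading {N : GrMod.{u, v, u} 𝒜} (f : ∀ i, M i ⟶ N) {g : G}
    {m : ⨁ i, (M i).carrier} (hm : ∀ i, m i ∈ (M i).grading g) :
    DirectSum.toModule Aᵐᵒᵖ ι N.carrier (fun i => Hom.toLin (f i)) m ∈ N.grading g := by
  rw [← DirectSum.sum_support_of m, map_sum]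
  refine sum_mem fun i _ => ?_
  rw [← DirectSum.lof_eq_of Aᵐᵒᵖ, DirectSum.toModule_lof]
  exact (f i).map_mem g _ (hm i)

open scoped Classical in
/-- The inclusion of a summand. -/
def directSumInj (i : ι) : M i ⟶ directSum M :=
  Hom.mk (N := directSum M) (DirectSum.lof Aᵐᵒᵖ ι (fun i => (M i).carrier) i)
    fun _ _ hm => lof_mem_grading M hm

open scoped Classical in
/-- The morphism from a direct sum with given restrictions to the summands. -/
def directSumDesc {N : GrMod.{u, v, u} 𝒜} (f : ∀ i, M i ⟶ N) : directSum M ⟶ N :=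
  Hom.mk (M := directSum M)
    (DirectSum.toModule Aᵐᵒᵖ ι N.carrier fun i => Hom.toLin (f i))
    fun _ _ hm => toModule_mem_grading M f hm

theorem directSumInj_desc {N : GrMod.{u, v, u} 𝒜} (f : ∀ i, M i ⟶ N) (i : ι) :
    directSumInj M i ≫ directSumDesc M f = f i :=
  Hom.ext (LinearMap.ext fun x => by
    classical
    exact DirectSum.toModule_lof Aᵐᵒᵖ (φ := fun i => Hom.toLin (f i)) i x)

/-- The direct sum as a cofan. -/
def directSumCofan : Cofan M := Cofan.mk (directSum M) (directSumInj M)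

/-- The direct sum is a coproduct. -/
def directSumIsColimit : IsColimit (directSumCofan M) :=
  Cofan.IsColimit.mk _ (fun t => directSumDesc M t.inj) (fun t i => directSumInj_desc M _ i)
    fun t m h => by
      classical
      refine Hom.ext (DirectSum.linearMap_ext Aᵐᵒᵖ fun i => LinearMap.ext fun x => ?_)
      have h1 := (h i).trans (directSumInj_desc M t.inj i).symm
      exact congrArg (fun φ : M i ⟶ t.pt => Hom.toLin φ x) h1

theorem isSmallObj_shift (g : G) : IsSmallObj (shift 𝒜 g) := by
  classical
  intro ι M c hc f
  -- The given coproduct is abstract. The comparison with the concrete direct sum gives coordinates,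
  -- in which the image of `1` has finite support.
  let e : c.pt ≅ directSum M := hc.coconePointUniqueUpToIso (directSumIsColimit M)
  let x : ⨁ i, (M i).carrier := Hom.toLin (f ≫ e.hom) (1 : A)
  have hx : ∀ i, x i ∈ (M i).grading g := (f ≫ e.hom).map_mem g _ (one_mem_shift (𝒜 := 𝒜) g)
  let s : Finset ι := DFinsupp.support x
  -- The element `x` seen in the finite subsum over its support. It is still of degree `g`, since
  -- the grading is componentwise, and so defines the factorization.
  let y : (directSum fun i : s => M i).carrier :=
    ∑ i : s, Hom.toLin (directSumInj (fun i : s => M i) i) (x i)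
  have hy : y ∈ (directSum fun i : s => M i).grading g :=
    sum_mem fun i _ => (directSumInj (fun i : s => M i) i).map_mem g _ (hx i)
  refine ⟨s, directSumCofan _, directSumIsColimit _, homOfMem _ hy, shift_hom_ext ?_⟩
  have hinj : ∀ i, directSumInj M i ≫ e.inv = c.inj i := fun i =>
    hc.comp_coconePointUniqueUpToIso_inv (directSumIsColimit M) ⟨i⟩
  have hx1 : Hom.toLin e.inv x = Hom.toLin f (1 : A) := by
    change Hom.toLin ((f ≫ e.hom) ≫ e.inv) (1 : A) = _
    rw [Category.assoc, e.hom_inv_id, Category.comp_id]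
  rw [← hx1]
  have hx2 : x = ∑ i ∈ s, Hom.toLin (directSumInj M i) (x i) :=
    (DirectSum.sum_support_of x).symm
  change Hom.toLin (directSumDesc (fun i : s => M i) fun i => c.inj i) (op (1 : A) • y) = _
  rw [op_one, one_smul, hx2, map_sum, map_sum, ← Finset.sum_coe_sort s]
  refine Finset.sum_congr rfl fun i _ => ?_
  have h1 := congrArg (fun φ : M i ⟶ c.pt => Hom.toLin φ (x i))
    (directSumInj_desc (fun i : s => M i) (fun i => c.inj i) i)
  have h2 := congrArg (fun φ : M i ⟶ c.pt => Hom.toLin φ (x i)) (hinj i)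
  exact h1.trans h2.symm

end Coproducts

end GrMod

namespace GroupCoring

variable {K : Type v} {A : Type u} {G : Type u} [CommRing K] [Ring A] [Algebra K A] [Group G]
    [DecidableEq G] (𝒜 : Additive G → Submodule K A) [GradedAlgebra 𝒜]

/-! ### Coefficients in `M ⊗_A AG` -/

section Coefficients

variable {M : Type w} [AddCommGroup M] [Module K M] [Module Aᵐᵒᵖ M] [IsScalarTower K Aᵐᵒᵖ M]

variable {𝒜} in
/-- Linear maps on `M ⊗_A AG` are determined by their values on the elements `m ⊗ g`. -/
theorem tensor_hom_ext {P : Type*} [AddCommGroup P] [Module K P]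
    {f f' : TensorA K A M (GroupCoring 𝒜) →ₗ[K] P}
    (h : ∀ m g, f (BTensor.mk ⊤ _ _ m (of 𝒜 g)) = f' (BTensor.mk ⊤ _ _ m (of 𝒜 g))) :
    f = f' := by
  refine BTensor.hom_ext fun m x => ?_
  induction x using induction with
  | zero => simp
  | add x y hx hy => simp [hx, hy]
  | smul_of a g => rw [← BTensor.mk_smul _ _ Algebra.mem_top, h]

/-- The coefficients of `x` in the left `A`-module `AG` with basis `G`. -/
def coeffs : GroupCoring 𝒜 →ₗ[A] G →₀ A :=
  (MonoidAlgebra.coeffLinearEquiv (S := A) (M := G) A).toLinearMap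

theorem coeffs_of (g : G) : coeffs 𝒜 (of 𝒜 g) = Finsupp.single g 1 := rfl

variable (M) in
/-- The map `M ⊗_A AG → ⨁_g M`, `m ⊗ a g ↦ m a` in the component `g`. -/
def tensorCoeffs : TensorA K A M (GroupCoring 𝒜) →ₗ[K] G →₀ M :=
  BTensor.lift
    (LinearMap.mk₂ K
      (fun m x => Finsupp.mapRange (fun a : A => op a • m) (by simp) (coeffs 𝒜 x))
      (fun m m' x => by ext; simp)
      (fun k m x => by ext g; simp [smul_comm k])
      (fun m x y => by ext; simp [add_smul])
      (fun k m x => by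
        have h : coeffs 𝒜 (k • x) = k • coeffs 𝒜 x := (coeffs 𝒜).map_smul_of_tower k x
        ext; simp [h]))
    fun m b _ x => by ext; simp [mul_smul]

@[simp] theorem tensorCoeffs_mk_of (m : M) (g : G) :
    tensorCoeffs 𝒜 M (BTensor.mk ⊤ _ _ m (of 𝒜 g)) = Finsupp.single g m := by
  refine (BTensor.lift_mk _ _ _ _).trans ?_
  simp [coeffs_of]

/-- The coefficient at `g` on `M ⊗_A AG`. -/
def tensorCoeff (g : G) : TensorA K A M (GroupCoring 𝒜) →ₗ[K] M :=
  Finsupp.lapply g ∘ₗ tensorCoeffs 𝒜 M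

@[simp] theorem tensorCoeff_mk_of (g : G) (m : M) (h : G) :
    tensorCoeff 𝒜 g (BTensor.mk ⊤ _ _ m (of 𝒜 h)) = if h = g then m else 0 := by
  simp [tensorCoeff, Finsupp.single_apply]

/-- The counit takes every `g` to `1`. With the counit axiom of a comodule, this makes each element
the sum of the coefficients of its coaction. -/
theorem rid_map_counit (t : TensorA K A M (GroupCoring 𝒜)) :
    TensorA.rid M (BTensor.map LinearMap.id (coring 𝒜).counit.left t) =
      (tensorCoeffs 𝒜 M t).sum fun _ m => m := by
  have h : TensorA.rid M ∘ₗ BTensor.map LinearMap.id (coring 𝒜).counit.left =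
      Finsupp.lsum K (fun _ => LinearMap.id) ∘ₗ tensorCoeffs 𝒜 M :=
    tensor_hom_ext fun m g => by simp [(isGrouplike_of 𝒜 g).counit_eq]
  exact LinearMap.congr_fun h t

/-- The coefficient at `g` on `AG ⊗_A AG`, as a left linear map. -/
def groupCoeff (g : G) : TensorA K A (GroupCoring 𝒜) (GroupCoring 𝒜) →ₗ[A] GroupCoring 𝒜 where
  toFun := tensorCoeff 𝒜 g
  map_add' := map_add _
  map_smul' a t := by
    have h : tensorCoeff 𝒜 g ∘ₗ (Algebra.lsmul K K _ a).restrictScalars K =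
        (Algebra.lsmul K K _ a).restrictScalars K ∘ₗ tensorCoeff (M := GroupCoring 𝒜) 𝒜 g :=
      tensor_hom_ext fun m g => by simp
    exact LinearMap.congr_fun h t

@[simp] theorem groupCoeff_mk_of (g : G) (x : GroupCoring 𝒜) (h : G) :
    groupCoeff 𝒜 g (BTensor.mk ⊤ _ _ x (of 𝒜 h)) = if h = g then x else 0 :=
  tensorCoeff_mk_of 𝒜 g x h

/-- The outer coefficient at `g` concerns only the last tensor factor, so it can be read after
reassociating. This brings it to the side on which the coassociativity axiom applies. -/
theorem tensorCoeff_eq_map_assoc (g : G)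
    (t : TensorA K A (TensorA K A M (GroupCoring 𝒜)) (GroupCoring 𝒜)) :
    tensorCoeff 𝒜 g t =
      BTensor.map LinearMap.id (groupCoeff 𝒜 g) (TensorA.assoc M _ _ t) := by
  have h : tensorCoeff 𝒜 g =
      BTensor.map LinearMap.id (groupCoeff 𝒜 g) ∘ₗ TensorA.assoc M _ _ := by
    refine tensor_hom_ext fun x h => ?_
    refine LinearMap.congr_fun (f := tensorCoeff 𝒜 g ∘ₗ (BTensor.mk ⊤ _ _).flip (of 𝒜 h))
      (g := BTensor.map LinearMap.id (groupCoeff 𝒜 g) ∘ₗ TensorA.assoc M _ _ ∘ₗ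
        (BTensor.mk ⊤ _ _).flip (of 𝒜 h)) (tensor_hom_ext fun m g' => ?_) x
    by_cases hg : h = g <;> simp [hg]
  exact LinearMap.congr_fun h t

/-- Since `Δ(h) = h ⊗ h`, extracting `g` from the last factor leaves exactly the part of `t`
supported at `g`. -/
theorem map_groupCoeff_comul (g : G) (t : TensorA K A M (GroupCoring 𝒜)) :
    BTensor.map LinearMap.id (groupCoeff 𝒜 g)
        (BTensor.map LinearMap.id (coring 𝒜).comul.left t) =
      BTensor.mk ⊤ _ _ (tensorCoeff 𝒜 g t) (of 𝒜 g) := by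
  refine LinearMap.congr_fun (f := BTensor.map LinearMap.id (groupCoeff 𝒜 g) ∘ₗ
    BTensor.map LinearMap.id (coring 𝒜).comul.left)
    (g := (BTensor.mk ⊤ _ _).flip (of 𝒜 g) ∘ₗ tensorCoeff 𝒜 g) (tensor_hom_ext fun m h => ?_) t
  by_cases hg : h = g
  · subst hg
    simp [(isGrouplike_of 𝒜 h).comul_eq]
  · simp [(isGrouplike_of 𝒜 h).comul_eq, hg]

theorem tensorCoeff_map {N : Type*} [AddCommGroup N] [Module K N] [Module Aᵐᵒᵖ N]
    [IsScalarTower K Aᵐᵒᵖ N] (f : M →ₗ[Aᵐᵒᵖ] N) (g : G) (t : TensorA K A M (GroupCoring 𝒜)) :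
    tensorCoeff 𝒜 g (BTensor.map f LinearMap.id t) = f (tensorCoeff 𝒜 g t) := by
  refine LinearMap.congr_fun (f := tensorCoeff 𝒜 g ∘ₗ BTensor.map f LinearMap.id)
    (g := f.restrictScalars K ∘ₗ tensorCoeff 𝒜 g) (tensor_hom_ext fun m h => ?_) t
  by_cases hg : h = g <;> simp [hg]

end Coefficients

/-! ### The isomorphism between comodules and graded modules -/

section Functors

/-- The component `{m | ρ(m) = m ⊗ g}` of degree `g` of a comodule. -/
def component (M : RComod.{w} (coring 𝒜)) (g : G) : Submodule K M.carrier :=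
  LinearMap.eqLocus (M.coact.restrictScalars K) ((BTensor.mk ⊤ _ _).flip (of 𝒜 g))

variable {𝒜}

theorem mem_component {M : RComod.{w} (coring 𝒜)} {g : G} {m : M.carrier} :
    m ∈ component 𝒜 M g ↔ M.coact m = BTensor.mk ⊤ _ _ m (of 𝒜 g) := Iff.rfl

/-- Coassociativity at work: `ρ(m_g)` is the outer coefficient at `g` of `(ρ ⊗ id)ρ(m)`, hence that
of `(id ⊗ Δ)ρ(m)`, which is `m_g ⊗ g`. -/
theorem tensorCoeff_coact_mem (M : RComod.{w} (coring 𝒜)) (g : G) (m : M.carrier) :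
    tensorCoeff 𝒜 g (M.coact m) ∈ component 𝒜 M g := by
  rw [mem_component, ← tensorCoeff_map, tensorCoeff_eq_map_assoc, M.coassoc, map_groupCoeff_comul]

theorem isInternal_component (M : RComod.{w} (coring 𝒜)) :
    DirectSum.IsInternal (component 𝒜 M) := by
  refine isInternal_of_proj (fun g => tensorCoeff 𝒜 g ∘ₗ M.coact.restrictScalars K)
    (fun g m hm => ?_) (fun g h hgh m hm => ?_) (eq_top_iff.2 fun m _ => ?_)
  · change tensorCoeff 𝒜 g (M.coact m) = m
    simp [mem_component.1 hm]
  · change tensorCoeff 𝒜 g (M.coact m) = 0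
    simp [mem_component.1 hm, hgh]
  -- Spanning is the counit axiom: `m` is the sum of its coefficients, each of which lies in its
  -- component.
  · rw [← M.coact_counit m, rid_map_counit]
    exact sum_mem fun g _ => Submodule.mem_iSup_of_mem g (tensorCoeff_coact_mem M g m)

theorem map_mem_component {M N : RComod.{w} (coring 𝒜)} (f : M ⟶ N) {g : G} {m : M.carrier}
    (hm : m ∈ component 𝒜 M g) : RComod.Hom.toLin f m ∈ component 𝒜 N g := by
  rw [mem_component, ← RComod.Hom.comm f, mem_component.1 hm, BTensor.map_mk, LinearMap.id_apply]

/-- The graded module of a comodule. -/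
def toGrModObj (M : RComod.{w} (coring 𝒜)) : GrMod.{u, v, w} 𝒜 where
  carrier := M.carrier
  grading := component 𝒜 M
  isInternal := isInternal_component M
  smul_mem {g h m a} hm ha := by
    rw [mem_component, map_smul, mem_component.1 hm, BTensor.op_smul_mk, op_smul_of 𝒜 ha,
      BTensor.mk_smul _ _ Algebra.mem_top]

variable (𝒜) in
/-- The functor from comodules to graded modules. -/
def toGrMod : RComod.{w} (coring 𝒜) ⥤ GrMod.{u, v, w} 𝒜 where
  obj := toGrModObj
  map {M N} f := GrMod.Hom.mk (M := toGrModObj M) (N := toGrModObj N) (RComod.Hom.toLin f)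
    fun _ _ hm => map_mem_component f hm

/-- The linear map `m ↦ ∑_g m_g ⊗ g` on a graded module. -/
def gradedCoactBase (M : GrMod.{u, v, w} 𝒜) :
    M.carrier →ₗ[K] TensorA K A M.carrier (GroupCoring 𝒜) :=
  DirectSum.toModule K G _
    (fun g => (BTensor.mk ⊤ _ _).flip (of 𝒜 g) ∘ₗ (M.grading g).subtype) ∘ₗ
    M.decompose.toLinearMap

theorem gradedCoactBase_of_mem (M : GrMod.{u, v, w} 𝒜) {g : G} {m : M.carrier}
    (hm : m ∈ M.grading g) : gradedCoactBase M m = BTensor.mk ⊤ _ _ m (of 𝒜 g) := by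
  simp [gradedCoactBase, M.decompose_of_mem hm]

/-- The coaction `m ↦ ∑_g m_g ⊗ g` on a graded module. -/
def gradedCoact (M : GrMod.{u, v, w} 𝒜) :
    M.carrier →ₗ[Aᵐᵒᵖ] TensorA K A M.carrier (GroupCoring 𝒜) where
  toFun := gradedCoactBase M
  map_add' := map_add _
  map_smul' r m := by
    rw [RingHom.id_apply]
    induction r using MulOpposite.rec' with | _ a => ?_
    induction a using DirectSum.Decomposition.inductionOn 𝒜 with
    | zero => simp
    | add a b ha hb => rw [MulOpposite.op_add, add_smul, add_smul, map_add, ha, hb]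
    | @homogeneous h a =>
      induction m using M.homogeneous_induction with
      | zero => simp
      | add m n hm hn => rw [smul_add, map_add, map_add, smul_add, hm, hn]
      | mem g m hm =>
        have ha : (a : A) ∈ 𝒜 (Additive.ofMul h.toMul) := a.2
        rw [gradedCoactBase_of_mem M hm, gradedCoactBase_of_mem M (M.smul_mem hm ha),
          BTensor.op_smul_mk, op_smul_of 𝒜 ha, BTensor.mk_smul _ _ Algebra.mem_top]

theorem gradedCoact_of_mem (M : GrMod.{u, v, w} 𝒜) {g : G} {m : M.carrier}
    (hm : m ∈ M.grading g) : gradedCoact M m = BTensor.mk ⊤ _ _ m (of 𝒜 g) :=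
  gradedCoactBase_of_mem M hm

/-- The comodule of a graded module. -/
def ofGrModObj (M : GrMod.{u, v, w} 𝒜) : RComod.{w} (coring 𝒜) where
  carrier := M.carrier
  coact := gradedCoact M
  coassoc m := by
    induction m using M.homogeneous_induction with
    | zero => simp
    | add m n hm hn => simp only [map_add, hm, hn]
    | mem g m hm => simp [gradedCoact_of_mem M hm, (isGrouplike_of 𝒜 g).comul_eq]
  coact_counit m := by
    induction m using M.homogeneous_induction with
    | zero => simp
    | add m n hm hn => simp only [map_add, hm, hn]
    | mem g m hm => simp [gradedCoact_of_mem M hm, (isGrouplike_of 𝒜 g).counit_eq]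

variable (𝒜) in
/-- The functor from graded modules to comodules. -/
def ofGrMod : GrMod.{u, v, w} 𝒜 ⥤ RComod.{w} (coring 𝒜) where
  obj := ofGrModObj
  map {M N} f := RComod.Hom.mk (M := ofGrModObj M) (N := ofGrModObj N) (GrMod.Hom.toLin f)
    fun m => by
      change BTensor.map (GrMod.Hom.toLin f) LinearMap.id (gradedCoact M m) =
        gradedCoact N (GrMod.Hom.toLin f m)
      induction m using M.homogeneous_induction with
      | zero => simp
      | add m n hm hn => simp only [map_add, hm, hn]
      | mem g m hm =>
        rw [gradedCoact_of_mem M hm, gradedCoact_of_mem N (GrMod.Hom.map_mem f g m hm),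
          BTensor.map_mk, LinearMap.id_apply]

theorem gradedCoact_toGrModObj (M : RComod.{w} (coring 𝒜)) :
    gradedCoact (toGrModObj M) = M.coact := by
  refine LinearMap.ext fun m => ?_
  induction m using (toGrModObj M).homogeneous_induction with
  | zero => rw [map_zero]; exact (map_zero M.coact).symm
  | add m n hm hn => rw [map_add, hm, hn]; exact (map_add M.coact m n).symm
  | mem g m hm => exact (gradedCoact_of_mem (toGrModObj M) hm).trans (mem_component.1 hm).symm

/-- The round trip keeps the carrier and its module structures, so equality of objects reduces to
equality of coactions. Strict equality is needed for an isomorphism of categories. -/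
theorem _root_.RComod.mk_eq_of_coact {M : RComod.{w} (coring 𝒜)}
    {ρ : M.carrier →ₗ[Aᵐᵒᵖ] TensorA K A M.carrier (GroupCoring 𝒜)} (h : ρ = M.coact) (h1 h2) :
    RComod.mk (𝒞 := coring 𝒜) M.carrier ρ h1 h2 = M := by
  subst h; rfl

theorem _root_.GrMod.mk_eq_of_grading {M : GrMod.{u, v, w} 𝒜}
    {S : G → Submodule K M.carrier} (h : S = M.grading) (h1 h2) :
    GrMod.mk (𝒜 := 𝒜) M.carrier S h1 h2 = M := by
  subst h; rfl

theorem ofGrModObj_toGrModObj (M : RComod.{w} (coring 𝒜)) :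
    ofGrModObj (toGrModObj M) = M :=
  RComod.mk_eq_of_coact (gradedCoact_toGrModObj M) _ _

/-- The coefficient at `g` of any coaction is of degree `g`. If the coaction of `m` is `m ⊗ g`, this
coefficient is `m` itself. -/
theorem mem_grading_of_gradedCoact (M : GrMod.{u, v, w} 𝒜) {g : G} {m : M.carrier}
    (hm : gradedCoact M m = BTensor.mk ⊤ _ _ m (of 𝒜 g)) : m ∈ M.grading g := by
  have key : ∀ m : M.carrier, tensorCoeff 𝒜 g (gradedCoact M m) ∈ M.grading g := fun m => by
    induction m using M.homogeneous_induction with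
    | zero => simp
    | add m n hm hn => rw [map_add, map_add]; exact add_mem hm hn
    | mem h m hm =>
      rw [gradedCoact_of_mem M hm, tensorCoeff_mk_of]
      split_ifs with hg
      · exact hg ▸ hm
      · exact zero_mem _
  have h := key m
  rw [hm, tensorCoeff_mk_of, if_pos rfl] at h
  exact h

theorem component_ofGrModObj (M : GrMod.{u, v, w} 𝒜) :
    component 𝒜 (ofGrModObj M) = M.grading := by
  refine funext fun g => le_antisymm (fun m hm => mem_grading_of_gradedCoact M hm)
    fun m hm => gradedCoact_of_mem M hm

theorem toGrModObj_ofGrModObj (M : GrMod.{u, v, w} 𝒜) :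
    toGrModObj (ofGrModObj M) = M :=
  GrMod.mk_eq_of_grading (component_ofGrModObj M) _ _

/-- Moves the transport along an equality of objects to the underlying modules. In a round trip
these coincide definitionally, so the transport becomes the identity map. -/
theorem _root_.RComod.toLin_eqToHom {M N : RComod.{w} (coring 𝒜)} (h : M = N) :
    ModuleCat.ofHom (RComod.Hom.toLin (eqToHom h)) =
      eqToHom (congrArg (RComod.forget (coring 𝒜)).obj h) := by
  subst h; rfl

theorem _root_.GrMod.toLin_eqToHom {M N : GrMod.{u, v, w} 𝒜} (h : M = N) :
    ModuleCat.ofHom (GrMod.Hom.toLin (eqToHom h)) =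
      eqToHom (congrArg (GrMod.forget 𝒜).obj h) := by
  subst h; rfl

variable (𝒜)

theorem toGrMod_comp_ofGrMod : toGrMod.{u, v, w} 𝒜 ⋙ ofGrMod 𝒜 = 𝟭 _ := by
  refine CategoryTheory.Functor.ext ofGrModObj_toGrModObj fun M N f => RComod.Hom.ext ?_
  have h1 := RComod.toLin_eqToHom (ofGrModObj_toGrModObj M)
  have h2 := RComod.toLin_eqToHom (ofGrModObj_toGrModObj N).symm
  have h1' : RComod.Hom.toLin (eqToHom (ofGrModObj_toGrModObj M)) = LinearMap.id :=
    congrArg ModuleCat.Hom.hom h1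
  have h2' : RComod.Hom.toLin (eqToHom (ofGrModObj_toGrModObj N).symm) = LinearMap.id :=
    congrArg ModuleCat.Hom.hom h2
  refine LinearMap.ext fun m => ?_
  have h3 := LinearMap.congr_fun h1' m
  exact (congrArg (RComod.Hom.toLin f) h3.symm).trans (LinearMap.congr_fun h2' _).symm

theorem ofGrMod_comp_toGrMod : ofGrMod.{u, v, w} 𝒜 ⋙ toGrMod 𝒜 = 𝟭 _ := by
  refine CategoryTheory.Functor.ext toGrModObj_ofGrModObj fun M N f => GrMod.Hom.ext ?_
  have h1 := GrMod.toLin_eqToHom (toGrModObj_ofGrModObj M)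
  have h2 := GrMod.toLin_eqToHom (toGrModObj_ofGrModObj N).symm
  have h1' : GrMod.Hom.toLin (eqToHom (toGrModObj_ofGrModObj M)) = LinearMap.id :=
    congrArg ModuleCat.Hom.hom h1
  have h2' : GrMod.Hom.toLin (eqToHom (toGrModObj_ofGrModObj N).symm) = LinearMap.id :=
    congrArg ModuleCat.Hom.hom h2
  refine LinearMap.ext fun m => ?_
  have h3 := LinearMap.congr_fun h1' m
  exact (congrArg (GrMod.Hom.toLin f) h3.symm).trans (LinearMap.congr_fun h2' _).symm

/-- For `a` of degree `g⁻¹ h`, `1 ⊗ g a = 1 ⊗ a h = a ⊗ h`. This is why the shift has `A_{g⁻¹ h}` in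
degree `h`. -/
theorem coact_grouplike_of_mem {g h : G} {a : A} (ha : a ∈ 𝒜 (Additive.ofMul (g⁻¹ * h))) :
    (isGrouplike_of 𝒜 g).comodule.coact a = BTensor.mk ⊤ A _ a (of 𝒜 h) := by
  change BTensor.mk ⊤ A _ 1 (op a • of 𝒜 g) = _
  rw [op_smul_of 𝒜 ha, ← BTensor.mk_smul _ _ Algebra.mem_top, mul_inv_cancel_left, op_smul_eq_mul,
    one_mul]
  rfl

theorem gradedCoact_shift (g : G) :
    gradedCoact (GrMod.shift 𝒜 g) = (isGrouplike_of 𝒜 g).comodule.coact := by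
  refine LinearMap.ext fun m => ?_
  induction m using (GrMod.shift 𝒜 g).homogeneous_induction with
  | zero => rw [map_zero]; exact (map_zero (isGrouplike_of 𝒜 g).comodule.coact).symm
  | add m n hm hn =>
    rw [map_add, hm, hn]
    exact (map_add (isGrouplike_of 𝒜 g).comodule.coact m n).symm
  | mem h m hm => exact (gradedCoact_of_mem _ hm).trans (coact_grouplike_of_mem 𝒜 hm).symm

theorem toGrModObj_grouplike (g : G) :
    toGrModObj (isGrouplike_of 𝒜 g).comodule = GrMod.shift 𝒜 g := by
  -- The comparison is made among comodules, where only two coactions have to agree, and then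
  -- carried over by the round trip.
  have h : ofGrModObj (GrMod.shift 𝒜 g) = (isGrouplike_of 𝒜 g).comodule :=
    RComod.mk_eq_of_coact (M := (isGrouplike_of 𝒜 g).comodule) (gradedCoact_shift 𝒜 g) _ _
  rw [← h, toGrModObj_ofGrModObj]

end Functors

end GroupCoring

namespace ComatrixCoring

/-! ### Compatibility of `can` with the coring structures -/

section Grouplike

variable {K A C : Type*} [CommRing K] [Ring A] [Algebra K A] [AddCommGroup C]
    [Module K C] [Module A C] [Module Aᵐᵒᵖ C] [SMulCommClass A Aᵐᵒᵖ C] [IsScalarTower K A C]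
    [IsScalarTower K Aᵐᵒᵖ C] {ι : Type*} [DecidableEq ι] {𝒞 : Coring K A C} {γ : ι → C}

/-- On a generator `a ⊗ a'` both sides equal `a γ_i ⊗ γ_i a'`, because `γ_i` is grouplike and `Δ` is
a bimodule map. -/
theorem comul_can (hγ : ∀ i, 𝒞.IsGrouplike (γ i)) (c : ComatrixCoring K A γ) :
    𝒞.comul.left ((can K γ).left c) =
      BTensor.map (can K γ).right (can K γ).left ((coring γ).comul.left c) := by
  refine LinearMap.congr_fun
    (f := 𝒞.comul.left.restrictScalars K ∘ₗ (can K γ).left.restrictScalars K)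
    (g := BTensor.map (can K γ).right (can K γ).left ∘ₗ
      (coring γ).comul.left.restrictScalars K) (hom_ext fun i a a' => ?_) c
  have h : (coring γ).comul.left (mk (K := K) γ i a a') =
      BTensor.mk ⊤ _ _ (mk γ i a 1) (mk γ i 1 a') := comul_mk i a a'
  simp [h, 𝒞.comul.map_op_smul, (hγ i).comul_eq]

theorem counit_can (hγ : ∀ i, 𝒞.IsGrouplike (γ i)) (c : ComatrixCoring K A γ) :
    𝒞.counit.left ((can K γ).left c) = (coring γ).counit.left c := by
  refine LinearMap.congr_fun
    (f := 𝒞.counit.left.restrictScalars K ∘ₗ (can K γ).left.restrictScalars K)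
    (g := (coring γ).counit.left.restrictScalars K) (hom_ext fun i a a' => ?_) c
  have h : (coring γ).counit.left (mk (K := K) γ i a a') = a * a' := counit_mk i a a'
  simp [h, 𝒞.counit.map_op_smul, (hγ i).counit_eq]

end Grouplike

/-! ### Bijectivity of `can` from a trace condition -/

section Graded

variable {K : Type v} {A : Type u} {G : Type u} [CommRing K] [Ring A] [Algebra K A] [Group G]
    [DecidableEq G] (𝒜 : Additive G → Submodule K A) [GradedAlgebra 𝒜] {ι : Type w}

/-- The additive span of the products `b a` with `b` and `a` homogeneous of degrees `g⁻¹ γ_i` and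
`γ_i⁻¹ g`. -/
def traceAt (γ : ι → G) (g : G) : AddSubmonoid A :=
  AddSubmonoid.closure {z | ∃ i, ∃ b ∈ 𝒜 (Additive.ofMul (g⁻¹ * γ i)),
    ∃ a ∈ 𝒜 (Additive.ofMul ((γ i)⁻¹ * g)), z = b * a}

variable {𝒜} {γ : ι → G}

theorem mem_intertwiner_of {i j : ι} {t : A} (ht : t ∈ 𝒜 (Additive.ofMul ((γ j)⁻¹ * γ i))) :
    t ∈ intertwiner K A (fun i => GroupCoring.of 𝒜 (γ i)) i j := by
  change op t • GroupCoring.of 𝒜 (γ j) = t • GroupCoring.of 𝒜 (γ i)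
  rw [GroupCoring.op_smul_of 𝒜 ht, mul_inv_cancel_left]

variable [DecidableEq ι]

/-- For `z = ∑ b c` the witness is the class of `∑ b ⊗ c`. The first property will make the map `g ↦
y` a right inverse of `can` when `z = 1`, the second a left inverse. -/
theorem exists_can_eq {g : G} {z : A} (hz : z ∈ traceAt 𝒜 γ g) :
    ∃ y : ComatrixCoring K A (fun i => GroupCoring.of 𝒜 (γ i)),
      (can K _).left y = z • GroupCoring.of 𝒜 g ∧
      ∀ j a, ∀ a' ∈ 𝒜 (Additive.ofMul ((γ j)⁻¹ * g)), (a * a') • y = mk _ j a (a' * z) := by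
  induction hz using AddSubmonoid.closure_induction with
  | zero => exact ⟨0, by simp, fun j a a' _ => by simp⟩
  | add z z' _ _ h h' =>
    obtain ⟨y, hy1, hy2⟩ := h
    obtain ⟨y', hy1', hy2'⟩ := h'
    refine ⟨y + y', by rw [map_add, hy1, hy1', add_smul], fun j a a' ha' => ?_⟩
    rw [smul_add, hy2 j a a' ha', hy2' j a a' ha', mul_add, map_add]
  | mem z hz =>
    obtain ⟨i, b, hb, c, hc, rfl⟩ := hz
    refine ⟨mk _ i b c, ?_, fun j a a' ha' => ?_⟩
    · rw [can_mk, GroupCoring.op_smul_of 𝒜 hc, mul_inv_cancel_left, mul_smul]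
    -- The product `a' b` has degree `γ_j⁻¹ γ_i`, so it lies in `A_{i,j}` and passes through the
    -- tensor sign: `a a' b ⊗_i c = a ⊗_j a' b c`.
    · have h := SetLike.mul_mem_graded ha' hb
      rw [← ofMul_mul, mul_assoc, mul_inv_cancel_left] at h
      rw [smul_mk, ← mul_assoc, mk_mul (mem_intertwiner_of h), mul_assoc]

theorem bijective_can (h : ∀ g, (1 : A) ∈ traceAt 𝒜 γ g) :
    Function.Bijective (can (A := A) K fun i => GroupCoring.of 𝒜 (γ i)).left := by
  choose y hy1 hy2 using fun g => exists_can_eq (h g)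
  refine Function.bijective_iff_has_inverse.2 ⟨GroupCoring.lift 𝒜 y, fun c => ?_, fun x => ?_⟩
  · refine LinearMap.congr_fun (f := (GroupCoring.lift 𝒜 y).restrictScalars K ∘ₗ
      (can (A := A) K fun i => GroupCoring.of 𝒜 (γ i)).left.restrictScalars K) (g := LinearMap.id)
      (hom_ext fun i a a' => ?_) c
    induction a' using DirectSum.Decomposition.inductionOn 𝒜 with
    | zero => simp
    | add b b' hb hb' => rw [map_add, map_add, map_add, hb, hb']
    | @homogeneous x b =>
      have hb : (b : A) ∈ 𝒜 (Additive.ofMul x.toMul) := b.2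
      -- For `b` of degree `x`, `can` sends `a ⊗_i b` to `a b (γ_i x)`. The second property of `y`
      -- is therefore used at the group element `γ_i x`.
      have hb' : (b : A) ∈ 𝒜 (Additive.ofMul ((γ i)⁻¹ * (γ i * x.toMul))) := by
        rwa [inv_mul_cancel_left]
      change GroupCoring.lift 𝒜 y ((can K _).left (mk _ i a b)) = mk _ i a b
      rw [can_mk, GroupCoring.op_smul_of 𝒜 hb, smul_smul, map_smul, GroupCoring.lift_of,
        hy2 _ i a b hb', mul_one]
  · refine LinearMap.congr_fun (f := (can (A := A) K fun i => GroupCoring.of 𝒜 (γ i)).left ∘ₗ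
      GroupCoring.lift 𝒜 y) (g := LinearMap.id) (GroupCoring.hom_ext fun g => ?_) x
    simp [hy1]

/-- The canonical map is an isomorphism of corings if the trace ideals are trivial. -/
theorem isIso_can (h : ∀ g, (1 : A) ∈ traceAt 𝒜 γ g) :
    (coring fun i => GroupCoring.of 𝒜 (γ i)).IsIso (GroupCoring.coring 𝒜)
      (can K fun i => GroupCoring.of 𝒜 (γ i)) where
  comul_map := comul_can fun i => GroupCoring.isGrouplike_of 𝒜 (γ i)
  counit_map := counit_can fun i => GroupCoring.isGrouplike_of 𝒜 (γ i)
  bijective := bijective_can h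

variable (𝒜) in
theorem one_mem_traceAt_id (g : G) : (1 : A) ∈ traceAt 𝒜 (fun g : G => g) g := by
  have h1 : (1 : A) ∈ 𝒜 (Additive.ofMul (g⁻¹ * g)) := by
    rw [inv_mul_cancel]
    exact SetLike.GradedOne.one_mem (A := 𝒜)
  exact AddSubmonoid.subset_closure ⟨g, 1, h1, 1, h1, (mul_one 1).symm⟩

end Graded

/-! ### The trace condition from a generator -/

section Separator

variable {K : Type v} {A : Type u} {G : Type u} [CommRing K] [Ring A] [Algebra K A] [Group G]
    [DecidableEq G] {𝒜 : Additive G → Submodule K A} [GradedAlgebra 𝒜] {ι : Type u} {γ : ι → G}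

/-- In `[g]A` the element `b` has degree `γ_i`, so only the component of `a` of degree `γ_i⁻¹ g`
contributes to degree `g`. -/
theorem comp_mul_mem_traceAt {g : G} {i : ι} {b : A} (hb : b ∈ 𝒜 (Additive.ofMul (g⁻¹ * γ i)))
    (a : A) : (GrMod.shift 𝒜 g).comp g (b * a : A) ∈ traceAt 𝒜 γ g := by
  induction a using DirectSum.Decomposition.inductionOn 𝒜 with
  | zero =>
    rw [mul_zero]
    exact (map_zero ((GrMod.shift 𝒜 g).comp g)).symm ▸ zero_mem (traceAt 𝒜 γ g)
  | add a a' ha ha' =>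
    rw [mul_add]
    exact (map_add ((GrMod.shift 𝒜 g).comp g) (b * a : A) (b * a' : A)).symm ▸ add_mem ha ha'
  | @homogeneous x a =>
    have ha : (a : A) ∈ 𝒜 (Additive.ofMul x.toMul) := a.2
    have hba : (b * a : A) ∈ (GrMod.shift 𝒜 g).grading (γ i * x.toMul) := by
      have h := SetLike.mul_mem_graded hb ha
      rwa [← ofMul_mul, mul_assoc] at h
    by_cases hx : γ i * x.toMul = g
    · have h : (GrMod.shift 𝒜 g).comp g (b * a : A) = (b * a : A) :=
        GrMod.comp_of_mem _ (hx ▸ hba)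
      rw [h]
      refine AddSubmonoid.subset_closure ⟨i, b, hb, a, ?_, rfl⟩
      rwa [← hx, inv_mul_cancel_left]
    · have h : (GrMod.shift 𝒜 g).comp g (b * a : A) = (0 : A) := GrMod.comp_of_mem_ne _ hba hx
      rw [h]
      exact zero_mem _

variable (𝒜 γ) in
/-- The submodule of `[g]A` generated by the components of degrees `γ_i`. -/
def traceSubmodule (g : G) : Submodule Aᵐᵒᵖ (GrMod.shift 𝒜 g).carrier :=
  Submodule.span Aᵐᵒᵖ {b | ∃ i, b ∈ (GrMod.shift 𝒜 g).grading (γ i)}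

/-- The scalar `r` is there for the induction: the trace is only an additive submonoid, so closure
under scalars has to be built into the statement. -/
theorem comp_mem_traceAt {g : G} {x : (GrMod.shift 𝒜 g).carrier}
    (hx : x ∈ traceSubmodule 𝒜 γ g) (r : Aᵐᵒᵖ) :
    (GrMod.shift 𝒜 g).comp g (r • x) ∈ traceAt 𝒜 γ g := by
  induction hx using Submodule.span_induction generalizing r with
  | zero =>
    rw [smul_zero, map_zero]
    exact zero_mem (traceAt 𝒜 γ g)
  | add x y _ _ hx hy =>
    rw [smul_add, map_add]
    exact add_mem (hx r) (hy r)
  | smul s x _ hx =>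
    rw [smul_smul]
    exact hx _
  | mem x hx =>
    obtain ⟨i, hi⟩ := hx
    exact comp_mul_mem_traceAt (𝒜 := 𝒜) (b := x) hi r.unop

theorem one_mem_traceAt (h : IsSeparator (GrMod.directSum fun i => GrMod.shift 𝒜 (γ i)))
    (g : G) : (1 : A) ∈ traceAt 𝒜 γ g := by
  have hN : ∀ m ∈ traceSubmodule 𝒜 γ g, ∀ x,
      (GrMod.shift 𝒜 g).comp x m ∈ traceSubmodule 𝒜 γ g :=
    fun m hm x => GrMod.comp_mem_span _ (fun _ hm => hm.elim fun i hi => ⟨γ i, hi⟩) hm x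
  have htop : traceSubmodule 𝒜 γ g = ⊤ := by
    -- A morphism from the generator to `[g]A` is determined by the images of the elements `1` of
    -- the summands. These have degrees `γ_i`, so they lie in the trace submodule and vanish in the
    -- quotient.
    refine GrMod.eq_top_of_quotientMk_eq_zeroHom _ _ hN (h _ _ ?_)
    rintro _ ⟨⟩ φ
    refine Cofan.IsColimit.hom_ext (GrMod.directSumIsColimit _) _ _ fun i =>
      GrMod.shift_hom_ext ?_
    refine (Submodule.Quotient.mk_eq_zero (traceSubmodule 𝒜 γ g)).2
      (Submodule.subset_span ⟨i, ?_⟩)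
    exact (GrMod.directSumInj _ i ≫ φ).map_mem (γ i) _ (GrMod.one_mem_shift (𝒜 := 𝒜) (γ i))
  have h1 : ∀ x : (GrMod.shift 𝒜 g).carrier, x ∈ (GrMod.shift 𝒜 g).grading g →
      x ∈ traceAt 𝒜 γ g := fun x hx => by
    have h2 := comp_mem_traceAt (htop.symm ▸ Submodule.mem_top : x ∈ traceSubmodule 𝒜 γ g) 1
    rwa [one_smul, GrMod.comp_of_mem _ hx] at h2
  exact h1 _ (GrMod.one_mem_shift (𝒜 := 𝒜) g)

end Separator

end ComatrixCoring

end

theorem mainTheorem10 {K : Type v} [CommRing K] {A : Type u} [Ring A] [Algebra K A]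
    {G : Type u} [Group G] [DecidableEq G] (𝒜 : Additive G → Submodule K A) [GradedAlgebra 𝒜] :
    -- the category of right `AG`-comodules is isomorphic, over the category of right `A`-modules,
    -- to the category of graded right `A`-modules, and `[g]A` corresponds to a shift of `A`
    (∃ (F : RComod.{u} (GroupCoring.coring 𝒜) ⥤ GrMod.{u, v, u} 𝒜)
        (F' : GrMod.{u, v, u} 𝒜 ⥤ RComod.{u} (GroupCoring.coring 𝒜)),
      F ⋙ F' = 𝟭 _ ∧ F' ⋙ F = 𝟭 _ ∧
      F ⋙ GrMod.forget 𝒜 = RComod.forget (GroupCoring.coring 𝒜) ∧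
      ∀ g : G, F.obj (GroupCoring.isGrouplike_of 𝒜 g).comodule = GrMod.shift 𝒜 g) ∧
    -- the shifts of `A` form a generating set of small projectives
    (ObjectProperty.ofObj (GrMod.shift 𝒜)).IsSeparating ∧
    (∀ g : G, Projective (GrMod.shift 𝒜 g) ∧ IsSmallObj (GrMod.shift 𝒜 g)) ∧
    -- `can : ℜ(G) → AG` is an isomorphism of `A`-corings
    (ComatrixCoring.coring (GroupCoring.of 𝒜)).IsIso (GroupCoring.coring 𝒜)
      (ComatrixCoring.can K (GroupCoring.of 𝒜)) ∧
    -- so is `can : ℜ(H) → AG` if `⨁_{h ∈ H} [h]A` is a generator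
    ∀ H : Subgroup G, IsSeparator (GrMod.directSum fun h : H => GrMod.shift 𝒜 (h : G)) →
      (ComatrixCoring.coring fun h : H => GroupCoring.of 𝒜 (h : G)).IsIso
        (GroupCoring.coring 𝒜) (ComatrixCoring.can K fun h : H => GroupCoring.of 𝒜 (h : G)) :=
  ⟨⟨GroupCoring.toGrMod 𝒜, GroupCoring.ofGrMod 𝒜, GroupCoring.toGrMod_comp_ofGrMod 𝒜,
      GroupCoring.ofGrMod_comp_toGrMod 𝒜, rfl, GroupCoring.toGrModObj_grouplike 𝒜⟩,
    GrMod.isSeparating_shift,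
    fun g => ⟨GrMod.projective_shift g, GrMod.isSmallObj_shift g⟩,
    ComatrixCoring.isIso_can (γ := fun g : G => g) (ComatrixCoring.one_mem_traceAt_id 𝒜),
    fun H hH => ComatrixCoring.isIso_can (γ := fun h : H => (h : G))
      (ComatrixCoring.one_mem_traceAt hH)⟩
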